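/- Let $G$ be a finite two-player zero-sum extensive-form game (with chance) with perfect recall, with maximizer $\vartriangle$ and minimizer $\triangledown$, let $\sigma_\triangledown^F$ be any strategy of $\triangledown$ in $G$, and let $p\in[0,1]$. Let $G^M$ be the restricted Nash response modification of $G$: an initial chance node chooses, with probabilities $p$ and $1-p$, one of two copies $G^F$ and $G'$ of $G$; $\vartriangle$ does not observe this choice (his information sets span both copies), $\triangledown$ does (her information sets are doubled). Two histories at which a player $i$ does not act are in the same augmented information set of $i$ if the sequences of information sets and actions of $i$ on the way to them agree; where $i$ acts, the augmented information sets are the information sets. Let the histories of $G^M$ be partitioned into public states, closed under membership in the augmented information sets of both players. A trunk is a set of histories closed under prefixes and public states; a subgame is a set of histories closed under extensions and public states. A subgame partitioning $\mathcal P$ of $G^M$ consists of trunks $\emptyset=T_0\subsetneq T_1\subsetneq\dots\subsetneq T_n$ with $T_n$ all of $G^M$, such that for every $k$ and every public state $c$ the histories that extend a history in $c$ lying directly below $T_k$ form a subgame. Write $S_k=T_k\setminus T_{k-1}$; thus $S_1=T_1$ is the initial trunk and $S_2,\dots,S_n$ are the successively added depth-limited subgames. Let $S_k^B$ be the set of histories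 directly below $S_k$ that are not in $T_k$, and let $S_k^O$ be the set of all other histories directly below $T_k$. For a set $X$ of histories let $|I_X|$ be the number of augmented information sets of $G^M$, of both players, that meet $X$. A value function assigns to a public state and to a range of each player (a probability distribution over the player's augmented information sets at the root histories of the public state) a value of each of these information sets, for both players. It is optimal if, for every public state at the depth limit of some $T_k$ and all ranges, these values are the conditional expected utilities of the information sets in some Nash equilibrium of the subgame whose root histories are weighted by the ranges and by chance (where $\triangledown$ is free in both copies). For a value function $W$ and a strategy profile $\sigma$ of $G^M$ let $$u_\vartriangle(\sigma)^{T_k}_W=\sum_{z\in T_k\text{ terminal}}\pi^\sigma(z)u_\vartriangle(z)+\sum_c\sum_I\pi^\sigma(I)\,W_\vartriangle(c,\text{ranges induced by }\sigma)(I),$$ the sums running over the public states $c$ directly below $T_k$ and the augmented information sets $I$ of $\vartriangle$ at the roots of $c$, with $\pi^\sigma(I)$ the probability of reaching a root of $c$ in $I$; the range of a player induced by $\sigma$ is the player's own contribution to the reach probabilities, normalized within $c$. Let $u_\vartriangle(\sigma_\vartriangle,BR(\sigma_\vartriangle))^{T_k}_W$ be the infimum of $u_\vartriangle(\sigma_\vartriangle,\sigma_\triangledown)^{T_k}_W$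 over the strategies $\sigma_\triangledown$ that follow $\sigma^F_\triangledown$ in $G^F$ and are arbitrary in $G'$. Let $V$ be an optimal value function and let $\bar V$ be a value function that differs from $V$ by at most $\epsilon_V$ at every public state at a depth limit, all ranges, and every information set of either player there. Let $\sigma^{\mathcal R}_\vartriangle$ be a continual depth-limited restricted Nash response computed with $\bar V$ and with regret at most $\epsilon_R$ in each step: for $k=1,\dots,n$ and every strategy $\tau_\vartriangle$ of $\vartriangle$ in $G^M$ that agrees with $\sigma^{\mathcal R}_\vartriangle$ on $T_{k-1}$, $$u_\vartriangle(\tau_\vartriangle,BR(\tau_\vartriangle))^{T_k}_{\bar V}\le u_\vartriangle(\sigma^{\mathcal R}_\vartriangle,BR(\sigma^{\mathcal R}_\vartriangle))^{T_k}_{\bar V}+\epsilon_R .$$ Let $\sigma^{NE}$ be any Nash equilibrium of $G$, and let $\mathcal S=\{S_1,\dots,S_n\}$ and $\mathcal S'=\{S_1,\dots,S_{n-1}\}$. Then, for the utilities in $G$, $$u_\vartriangle(\sigma^{\mathcal R}_\vartriangle,\sigma^F_\triangledown)+\sum_{S\in\mathcal S'}|I_{S^O}|(1-p)\epsilon_V+|\mathcal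 S|\epsilon_R+\sum_{S\in\mathcal S'}|I_{S^B}|\epsilon_V\ \ge\ u_\vartriangle(\sigma^{NE}).$$ -/

import Mathlib

open scoped BigOperators

/-- The two strategic players: the maximizer and the minimizer. Chance is not a `Player`. -/
inductive Player where
  | max
  | min
  deriving DecidableEq

/-- The other strategic player. -/
def Player.other : Player → Player
  | .max => .min
  | .min => .max

open Classical in
/-- The actions available at `h` in a tree `H` of histories. -/
noncomputable def availIn {A : Type*} [Fintype A] (H : Finset (List A)) (h : List A) : Finset A :=
  Finset.univ.filter fun a => h ++ [a] ∈ H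

/-- A finite two-player extensive-form game with chance. Histories are finite sequences of actions
and form a nonempty finite prefix tree `hist`. `turn h` is the player acting at the nonterminal
history `h`, with `none` for chance (and, as a dummy value, `none` at terminal histories).
`info i h` names the information set of player `i` that contains the history `h` of `i`. -/
structure Game (A ι : Type*) [Fintype A] where
  hist : Finset (List A)
  nil_mem : [] ∈ hist
  prefix_mem : ∀ h a, h ++ [a] ∈ hist → h ∈ hist
  turn : List A → Option Player
  turn_terminal : ∀ h ∈ hist, availIn hist h = ∅ → turn h = none
  chance : List A → A → ℝ
  chance_nonneg : ∀ h ∈ hist, turn h = none → ∀ a ∈ availIn hist h, 0 ≤ chance h a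
  chance_sum : ∀ h ∈ hist, turn h = none → availIn hist h ≠ ∅ →
    ∑ a ∈ availIn hist h, chance h a = 1
  info : Player → List A → ι
  avail_eq : ∀ i, ∀ h ∈ hist, ∀ h' ∈ hist, turn h = some i → turn h' = some i →
    info i h = info i h' → availIn hist h = availIn hist h'
  util : Player → List A → ℝ

/-- The product of the factors `f` along the path that starts at `g` and follows the actions `t`. -/
def pathProd {A : Type*} (f : List A → A → ℝ) : List A → List A → ℝ
  | _, [] => 1
  | g, a :: t => f g a * pathProd f (g ++ [a]) t

namespace Game

variable {A ι κ : Type*} [Fintype A]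

/-- `A(h)`. -/
noncomputable def avail (G : Game A ι) (h : List A) : Finset A := availIn G.hist h

open Classical in
/-- The terminal histories. -/
noncomputable def terminals (G : Game A ι) : Finset (List A) :=
  G.hist.filter fun z => G.avail z = ∅

/-- The utilities of the two players sum to zero at every leaf. -/
def IsZeroSum (G : Game A ι) : Prop :=
  ∀ z ∈ G.terminals, G.util .max z + G.util .min z = 0

/-- A (behavioural) strategy of player `i`: a probability distribution over the available actions
at each information set of `i`. Values of `prob` anywhere else are never used. -/
structure Strategy (G : Game A ι) (i : Player) where
  prob : ι → A → ℝ
  nonneg : ∀ h ∈ G.hist, G.turn h = some i → ∀ a ∈ G.avail h, 0 ≤ prob (G.info i h) a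
  sum_eq_one : ∀ h ∈ G.hist, G.turn h = some i → ∑ a ∈ G.avail h, prob (G.info i h) a = 1

/-- A strategy profile. -/
abbrev Profile (G : Game A ι) := (i : Player) → G.Strategy i

/-- The profile made of a strategy of the maximizer and one of the minimizer. -/
def profile {G : Game A ι} (σ : G.Strategy .max) (τ : G.Strategy .min) : G.Profile
  | .max => σ
  | .min => τ

/-- The probability of taking action `a` at history `g`. -/
def stepProb (G : Game A ι) (σ : G.Profile) (g : List A) (a : A) : ℝ :=
  match G.turn g with
  | none => G.chance g a
  | some i => (σ i).prob (G.info i g) a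

/-- `π^σ(h)`. -/
def reach (G : Game A ι) (σ : G.Profile) (h : List A) : ℝ := pathProd (G.stepProb σ) [] h

/-- The contribution of chance to the probability of reaching `h`. -/
def chanceReach (G : Game A ι) (h : List A) : ℝ :=
  pathProd (fun g a => match G.turn g with
    | none => G.chance g a
    | some _ => 1) [] h

/-- The expected payoff of player `i`. -/
noncomputable def utility (G : Game A ι) (i : Player) (σ : G.Profile) : ℝ :=
  ∑ z ∈ G.terminals, G.util i z * G.reach σ z

/-- Nash equilibrium. -/
def IsNash (G : Game A ι) (σ : G.Profile) : Prop :=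
  ∀ (i : Player) (τ : G.Strategy i), G.utility i (Function.update σ i τ) ≤ G.utility i σ

/-- The information sets of player `i` visited, and the actions of `i` taken, on the path that
starts at `g` and follows the actions `t`. -/
def ownSeqFrom (G : Game A ι) (i : Player) : List A → List A → List (ι × A)
  | _, [] => []
  | g, a :: t =>
      if G.turn g = some i then (G.info i g, a) :: G.ownSeqFrom i (g ++ [a]) t
      else G.ownSeqFrom i (g ++ [a]) t

/-- `H_i(h)`: the sequence of information sets and actions of player `i` on the path to `h`. -/
def ownSeq (G : Game A ι) (i : Player) (h : List A) : List (ι × A) := G.ownSeqFrom i [] h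

/-- Perfect recall. -/
def PerfectRecall (G : Game A ι) : Prop :=
  ∀ i, ∀ h ∈ G.hist, ∀ h' ∈ G.hist, G.turn h = some i → G.turn h' = some i →
    G.info i h = G.info i h' → G.ownSeq i h = G.ownSeq i h'

/-- Names of augmented information sets. -/
abbrev AugInfo (A ι : Type*) := Option ι × List (ι × A)

/-- The augmented information set of player `i` containing `h`. Where `i` acts it is the information
set (the second component is then determined by perfect recall); where `i` does not act, two
histories share it iff `H_i` agrees. -/
def augInfo (G : Game A ι) (i : Player) (h : List A) : AugInfo A ι :=
  (if G.turn h = some i then some (G.info i h) else none, G.ownSeq i h)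

open Classical in
/-- `|I_X|`: the number of (augmented) information sets, of both players, met by the set `X`. -/
noncomputable def infoCount (G : Game A ι) (X : Finset (List A)) : ℕ :=
  (X.image (G.augInfo .max)).card + (X.image (G.augInfo .min)).card

/-- `π_i^σ(I)`: the contribution of player `i` to reaching an augmented information set of `i`. -/
def ownReach {G : Game A ι} {i : Player} (σ : G.Strategy i) (I : AugInfo A ι) : ℝ :=
  (I.2.map fun x => σ.prob x.1 x.2).prod

/-! ### Public states, trunks and subgames

A partition of the histories into public states is given by a labelling `pub`. -/

/-- Public states are closed under membership in the augmented information sets of both players. -/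
def IsPublic (G : Game A ι) (pub : List A → κ) : Prop :=
  ∀ i, ∀ h ∈ G.hist, ∀ h' ∈ G.hist, G.augInfo i h = G.augInfo i h' → pub h = pub h'

/-- A set of histories closed under public states. -/
def PublicClosed (G : Game A ι) (pub : List A → κ) (X : Set (List A)) : Prop :=
  ∀ h ∈ X, ∀ h' ∈ G.hist, pub h' = pub h → h' ∈ X

/-- A trunk: a set of histories closed under prefixes and public states. -/
def IsTrunk (G : Game A ι) (pub : List A → κ) (T : Finset (List A)) : Prop :=
  T ⊆ G.hist ∧ (∀ h ∈ T, ∀ g, g <+: h → g ∈ T) ∧ G.PublicClosed pub (T : Set (List A))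

/-- A subgame: a forest closed under extensions and public states. -/
def IsSubgame (G : Game A ι) (pub : List A → κ) (S : Set (List A)) : Prop :=
  S ⊆ (G.hist : Set (List A)) ∧ (∀ h ∈ S, ∀ g ∈ G.hist, h <+: g → g ∈ S) ∧ G.PublicClosed pub S

open Classical in
/-- The histories right below `T` (the depth limit of the trunk `T`). -/
noncomputable def border (G : Game A ι) (T : Finset (List A)) : Finset (List A) :=
  G.hist.filter fun h => h ∉ T ∧ (h = [] ∨ h.dropLast ∈ T)

open Classical in
/-- The root histories of the public state `c`: those without a proper prefix in `c`. -/
noncomputable def roots (G : Game A ι) (pub : List A → κ) (c : κ) : Finset (List A) :=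
  G.hist.filter fun h => pub h = c ∧ ∀ g, g <+: h → g ≠ h → pub g ≠ c

open Classical in
/-- The (augmented) information sets of player `i` at the roots of the public state `c`. -/
noncomputable def pubInfos (G : Game A ι) (pub : List A → κ) (i : Player) (c : κ) :
    Finset (AugInfo A ι) :=
  (G.roots pub c).image (G.augInfo i)

/-! ### Value functions -/

/-- A value function takes a public state and the ranges of both players, and returns a value for
each information set in the public state, for both players. -/
abbrev ValueFn (A ι κ : Type*) :=
  κ → (Player → AugInfo A ι → ℝ) → Player → AugInfo A ι → ℝ

/-- `ρ` consists of a range of each player in the public state `c`: a probability distribution over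
the player's information sets. -/
def IsRanges (G : Game A ι) (pub : List A → κ) (c : κ) (ρ : Player → AugInfo A ι → ℝ) : Prop :=
  ∀ i, (∀ I, 0 ≤ ρ i I) ∧ (∀ I, I ∉ G.pubInfos pub i c → ρ i I = 0) ∧
    ∑ I ∈ G.pubInfos pub i c, ρ i I = 1

open Classical in
/-- The ranges induced by a profile: the players' own reach probabilities, normalized within the
public state. -/
noncomputable def ranges (G : Game A ι) (pub : List A → κ) (σ : G.Profile) (c : κ)
    (i : Player) (I : AugInfo A ι) : ℝ :=
  if I ∈ G.pubInfos pub i c then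
    ownReach (σ i) I / ∑ J ∈ G.pubInfos pub i c, ownReach (σ i) J
  else 0

open Classical in
/-- The expected utility of player `i` when play starts at `h` and follows `σ`:
`∑ π^σ(h, z) u_i(z)` over the leaves `z` below `h`. -/
noncomputable def contUtil (G : Game A ι) (i : Player) (σ : G.Profile) (h : List A) : ℝ :=
  ∑ z ∈ G.terminals.filter (fun z => h <+: z),
    pathProd (G.stepProb σ) h (z.drop h.length) * G.util i z

/-- The expected utility of player `i` in the subgame at the public state `c` whose roots are
weighted by the ranges `ρ` and by chance (up to a positive constant, which does not affect
equilibria). -/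
noncomputable def subUtil (G : Game A ι) (pub : List A → κ) (c : κ)
    (ρ : Player → AugInfo A ι → ℝ) (i : Player) (σ : G.Profile) : ℝ :=
  ∑ h ∈ G.roots pub c,
    ρ .max (G.augInfo .max h) * ρ .min (G.augInfo .min h) * G.chanceReach h * G.contUtil i σ h

/-- `σ` is a Nash equilibrium of the subgame at `c` with ranges `ρ`. -/
def IsSubNash (G : Game A ι) (pub : List A → κ) (c : κ) (ρ : Player → AugInfo A ι → ℝ)
    (σ : G.Profile) : Prop :=
  ∀ (i : Player) (τ : G.Strategy i),
    G.subUtil pub c ρ i (Function.update σ i τ) ≤ G.subUtil pub c ρ i σ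

/-- The weight of the root `h` for the opponent of `i` and chance. -/
noncomputable def cfWeight (G : Game A ι) (ρ : Player → AugInfo A ι → ℝ) (i : Player)
    (h : List A) : ℝ :=
  ρ i.other (G.augInfo i.other h) * G.chanceReach h

open Classical in
/-- `v` is the expected utility of player `i` under `σ` given that the information set `I` of `i`
in the public state `c` has been reached. It is written without division, so that nothing is
required of `v` if `I` is incompatible with the range of the opponent. -/
def IsInfoValue (G : Game A ι) (pub : List A → κ) (c : κ) (ρ : Player → AugInfo A ι → ℝ)
    (σ : G.Profile) (i : Player) (I : AugInfo A ι) (v : ℝ) : Prop :=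
  v * ∑ h ∈ (G.roots pub c).filter (fun h => G.augInfo i h = I), G.cfWeight ρ i h =
    ∑ h ∈ (G.roots pub c).filter (fun h => G.augInfo i h = I),
      G.cfWeight ρ i h * G.contUtil i σ h

open Classical in
/-- `u_i(σ)^T_V`: the utility of player `i` if `σ` is used in the trunk `T` and the information sets
at the depth limit are evaluated by `V`. -/
noncomputable def trunkUtil (G : Game A ι) (pub : List A → κ) (V : ValueFn A ι κ)
    (T : Finset (List A)) (i : Player) (σ : G.Profile) : ℝ :=
  (∑ z ∈ G.terminals.filter (fun z => z ∈ T), G.util i z * G.reach σ z) +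
    ∑ c ∈ (G.border T).image pub, ∑ I ∈ G.pubInfos pub i c,
      (∑ h ∈ (G.roots pub c).filter (fun h => G.augInfo i h = I), G.reach σ h) *
        V c (G.ranges pub σ c) i I

/-- A subgame partitioning: public states and trunks `∅ = T_0 ⊂ T_1 ⊂ ... ⊂ T_n`, where `T_n` is the
whole game. `T_1` is the initial trunk, and `T_k \ T_{k-1}` is the (depth-limited) subgame `S_k`
added in step `k`. What lies below a depth limit splits into subgames, one for each public state at
the depth limit. -/
structure SubgamePartitioning (G : Game A ι) (κ : Type*) where
  pub : List A → κ
  isPublic : G.IsPublic pub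
  n : ℕ
  trunk : ℕ → Finset (List A)
  trunk_zero : trunk 0 = ∅
  trunk_last : trunk n = G.hist
  trunk_ssubset : ∀ k < n, trunk k ⊂ trunk (k + 1)
  isTrunk : ∀ k ≤ n, G.IsTrunk pub (trunk k)
  isSubgame : ∀ k ≤ n, ∀ c,
    G.IsSubgame pub {g | g ∈ G.hist ∧ ∃ h ∈ G.border (trunk k), pub h = c ∧ h <+: g}

namespace SubgamePartitioning

variable {G : Game A ι}

/-- The subgame `S_k` added in step `k ≥ 1` (the initial trunk if `k = 1`). -/
noncomputable def added (P : G.SubgamePartitioning κ) (k : ℕ) : Set (List A) :=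
  {h | h ∈ P.trunk k ∧ h ∉ P.trunk (k - 1)}

open Classical in
/-- `S^B` for `S = S_k`: the states right below `S_k`. -/
noncomputable def borderB (P : G.SubgamePartitioning κ) (k : ℕ) : Finset (List A) :=
  (G.border (P.trunk k)).filter fun h => h.dropLast ∈ P.added k

open Classical in
/-- `S^O` for `S = S_k`: the other states where the value function is used in step `k`. -/
noncomputable def borderO (P : G.SubgamePartitioning κ) (k : ℕ) : Finset (List A) :=
  (G.border (P.trunk k)).filter fun h => h ∉ P.borderB k

/-- The public states at the depth limit of some step (where a value function is needed). -/
def AtDepthLimit (P : G.SubgamePartitioning κ) (c : κ) : Prop :=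
  ∃ k, 1 ≤ k ∧ k ≤ P.n ∧ ∃ h ∈ G.border (P.trunk k), P.pub h = c

/-- `V` is an optimal value function: for all public states and ranges it returns the values of some
Nash equilibrium of the subgame after the depth limit. -/
def IsOptimal (P : G.SubgamePartitioning κ) (V : ValueFn A ι κ) : Prop :=
  ∀ c, P.AtDepthLimit c → ∀ ρ, G.IsRanges P.pub c ρ →
    ∃ σ : G.Profile, G.IsSubNash P.pub c ρ σ ∧
      ∀ i, ∀ I ∈ G.pubInfos P.pub i c, G.IsInfoValue P.pub c ρ σ i I (V c ρ i I)

/-- `V'` approximates `V` with error at most `ε`. -/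
def ErrorLE (P : G.SubgamePartitioning κ) (V' V : ValueFn A ι κ) (ε : ℝ) : Prop :=
  ∀ c, P.AtDepthLimit c → ∀ ρ, G.IsRanges P.pub c ρ →
    ∀ i, ∀ I ∈ G.pubInfos P.pub i c, |V' c ρ i I - V c ρ i I| ≤ ε

end SubgamePartitioning

/-- Two strategies of player `i` coincide on the set `T` of histories. -/
def Strategy.AgreeOn {G : Game A ι} {i : Player} (σ τ : G.Strategy i) (T : Finset (List A)) :
    Prop :=
  ∀ h ∈ T, G.turn h = some i → ∀ a ∈ G.avail h, σ.prob (G.info i h) a = τ.prob (G.info i h) a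

/-! ### The restricted Nash response modification

Histories of the modified game are `[]` and `inl c :: h` with `h` a history of `G`, where `c = true`
marks the copy in which the minimizer follows the model and `c = false` the ordinary copy. -/

/-- The history of the modified game that corresponds to `h` in copy `c`. -/
def embed (c : Bool) (h : List A) : List (Bool ⊕ A) := Sum.inl c :: h.map Sum.inr

/-- The history of `G` underlying a history of the modified game. -/
def strip (l : List (Bool ⊕ A)) : List A := l.filterMap Sum.getRight?

open Classical in
/-- The histories of the modified game. -/
noncomputable def rnrHist (G : Game A ι) : Finset (List (Bool ⊕ A)) :=
  insert [] (Finset.univ.biUnion fun c => G.hist.image (embed c))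

theorem strip_embed {B : Type*} (c : Bool) (h : List B) : strip (embed c h) = h := by
  simp only [strip, embed, List.filterMap_cons, Sum.getRight?_inl, List.filterMap_map]
  induction h with
  | nil => rfl
  | cons a t ih => simp_all

theorem strip_map_inr {B : Type*} (h : List B) : strip (h.map Sum.inr) = h :=
  strip_embed true h

theorem embed_injective {B : Type*} (c c' : Bool) (h h' : List B) (e : embed c h = embed c' h') :
    c = c' ∧ h = h' := by
  refine ⟨?_, ?_⟩
  · simp only [embed, List.cons.injEq, Sum.inl.injEq] at e
    exact e.1
  · rw [← strip_embed c h, e, strip_embed]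

theorem mem_rnrHist (G : Game A ι) (l : List (Bool ⊕ A)) :
    l ∈ G.rnrHist ↔ l = [] ∨ ∃ c, ∃ h ∈ G.hist, l = embed c h := by
  simp only [rnrHist, Finset.mem_insert, Finset.mem_biUnion, Finset.mem_univ, true_and,
    Finset.mem_image]
  constructor
  · rintro (h | ⟨c, h, hh, rfl⟩)
    · exact Or.inl h
    · exact Or.inr ⟨c, h, hh, rfl⟩
  · rintro (h | ⟨c, h, hh, rfl⟩)
    · exact Or.inl h
    · exact Or.inr ⟨c, h, hh, rfl⟩

theorem embed_mem_rnrHist (G : Game A ι) (c : Bool) (h : List A) :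
    embed c h ∈ G.rnrHist ↔ h ∈ G.hist := by
  rw [mem_rnrHist]
  constructor
  · rintro (e | ⟨c', h', hh, e⟩)
    · simp [embed] at e
    · rw [(embed_injective _ _ _ _ e).2]; exact hh
  · intro hh
    exact Or.inr ⟨c, h, hh, rfl⟩

theorem embed_append {B : Type*} (c : Bool) (h : List B) (a : B) :
    embed c h ++ [Sum.inr a] = embed c (h ++ [a]) := by
  simp [embed]

theorem availIn_embed (G : Game A ι) (c : Bool) (h : List A) :
    availIn G.rnrHist (embed c h) = (availIn G.hist h).map ⟨Sum.inr, Sum.inr_injective⟩ := by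
  ext x
  simp only [availIn, Finset.mem_filter, Finset.mem_univ, true_and, Finset.mem_map,
    Function.Embedding.coeFn_mk]
  constructor
  · intro hx
    rcases x with b | a
    · exfalso
      rw [mem_rnrHist] at hx
      rcases hx with e | ⟨c', h', -, e⟩
      · simp at e
      · simp only [embed, List.cons_append, List.cons.injEq] at e
        have : (Sum.inl b : Bool ⊕ A) ∈ h'.map Sum.inr := by rw [← e.2]; simp
        simp at this
    · rw [embed_append, embed_mem_rnrHist] at hx
      exact ⟨a, hx, rfl⟩
  · rintro ⟨a, ha, rfl⟩
    rw [embed_append, embed_mem_rnrHist]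
    exact ha

theorem availIn_rnr_nil (G : Game A ι) :
    availIn G.rnrHist [] = Finset.univ.map ⟨Sum.inl, Sum.inl_injective⟩ := by
  ext x
  simp only [availIn, Finset.mem_filter, Finset.mem_univ, true_and, List.nil_append,
    Finset.mem_map, Function.Embedding.coeFn_mk]
  rw [mem_rnrHist]
  constructor
  · rintro (e | ⟨c, h, -, e⟩)
    · simp at e
    · simp only [embed, List.cons.injEq] at e
      exact ⟨c, e.1.symm⟩
  · rintro ⟨c, rfl⟩
    exact Or.inr ⟨c, [], G.nil_mem, rfl⟩

/-- The acting player in the modified game: chance at the new root, as in `G` afterwards. -/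
def rnrTurn (G : Game A ι) : List (Bool ⊕ A) → Option Player
  | [] => none
  | _ :: t => G.turn (strip t)

/-- Chance in the modified game: the copy `true` has probability `p`. -/
def rnrChance (G : Game A ι) (p : ℝ) : List (Bool ⊕ A) → Bool ⊕ A → ℝ
  | [], .inl true => p
  | [], .inl false => 1 - p
  | _ :: t, .inr a => G.chance (strip t) a
  | _, _ => 0

/-- Information sets of the modified game: the maximizer does not observe the copy, so that his
information sets span both copies; the minimizer does, so that his information sets are doubled. -/
def rnrInfo (G : Game A ι) : Player → List (Bool ⊕ A) → ι ⊕ (Bool × ι)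
  | .min, .inl c :: t => .inr (c, G.info .min (strip t))
  | i, l => .inl (G.info i (strip l))

theorem rnrTurn_embed (G : Game A ι) (c : Bool) (h : List A) :
    G.rnrTurn (embed c h) = G.turn h := by
  simp [rnrTurn, embed, strip_map_inr]

theorem rnrChance_embed (G : Game A ι) (p : ℝ) (c : Bool) (h : List A) (a : A) :
    G.rnrChance p (embed c h) (Sum.inr a) = G.chance h a := by
  simp [rnrChance, embed, strip_map_inr]

theorem rnrInfo_max_embed (G : Game A ι) (c : Bool) (h : List A) :
    G.rnrInfo .max (embed c h) = Sum.inl (G.info .max h) := by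
  have := strip_embed c h
  simp only [embed] at this ⊢
  simp [rnrInfo, this]

theorem rnrInfo_min_embed (G : Game A ι) (c : Bool) (h : List A) :
    G.rnrInfo .min (embed c h) = Sum.inr (c, G.info .min h) := by
  simp [rnrInfo, embed, strip_map_inr]

/-- The restricted Nash response modification of `G` with parameter `p`. -/
noncomputable def rnr (G : Game A ι) (p : ℝ) (hp : p ∈ Set.Icc (0 : ℝ) 1) :
    Game (Bool ⊕ A) (ι ⊕ (Bool × ι)) where
  hist := G.rnrHist
  nil_mem := (G.mem_rnrHist []).2 (Or.inl rfl)
  prefix_mem := by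
    intro l x hx
    rw [mem_rnrHist] at hx
    rcases hx with e | ⟨c, h, hh, e⟩
    · simp at e
    · rcases l with _ | ⟨y, t⟩
      · exact (G.mem_rnrHist []).2 (Or.inl rfl)
      · simp only [embed, List.cons_append, List.cons.injEq] at e
        obtain ⟨rfl, e⟩ := e
        obtain ⟨l₁, l₂, rfl, h1, h2⟩ := List.append_eq_map_iff.1 e
        rw [← h1]
        refine (G.embed_mem_rnrHist c l₁).2 ?_
        obtain ⟨a, rfl, -⟩ := List.map_eq_singleton_iff.1 h2
        exact G.prefix_mem _ _ hh
  turn := G.rnrTurn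
  turn_terminal := by
    intro l hl h0
    rcases (G.mem_rnrHist l).1 hl with rfl | ⟨c, h, hh, rfl⟩
    · rfl
    · rw [rnrTurn_embed]
      rw [availIn_embed, Finset.map_eq_empty] at h0
      exact G.turn_terminal h hh h0
  chance := G.rnrChance p
  chance_nonneg := by
    intro l hl ht x hx
    rcases (G.mem_rnrHist l).1 hl with rfl | ⟨c, h, hh, rfl⟩
    · rw [availIn_rnr_nil, Finset.mem_map] at hx
      obtain ⟨c, -, rfl⟩ := hx
      cases c
      · exact sub_nonneg.2 hp.2
      · exact hp.1
    · rw [rnrTurn_embed] at ht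
      rw [availIn_embed, Finset.mem_map] at hx
      obtain ⟨a, ha, rfl⟩ := hx
      simp only [Function.Embedding.coeFn_mk, rnrChance_embed]
      exact G.chance_nonneg h hh ht a ha
  chance_sum := by
    intro l hl ht h0
    rcases (G.mem_rnrHist l).1 hl with rfl | ⟨c, h, hh, rfl⟩
    · rw [availIn_rnr_nil, Finset.sum_map]
      simp [rnrChance]
    · rw [rnrTurn_embed] at ht
      rw [availIn_embed] at h0 ⊢
      rw [Finset.sum_map]
      simp only [Function.Embedding.coeFn_mk, rnrChance_embed]
      exact G.chance_sum h hh ht (fun e => h0 (by rw [e]; rfl))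
  info := G.rnrInfo
  avail_eq := by
    intro i l hl l' hl' ht ht' e
    rcases (G.mem_rnrHist l).1 hl with rfl | ⟨c, h, hh, rfl⟩
    · simp [rnrTurn] at ht
    rcases (G.mem_rnrHist l').1 hl' with rfl | ⟨c', h', hh', rfl⟩
    · simp [rnrTurn] at ht'
    rw [rnrTurn_embed] at ht ht'
    rw [availIn_embed, availIn_embed]
    congr 1
    apply G.avail_eq i h hh h' hh' ht ht'
    cases i
    · rw [rnrInfo_max_embed, rnrInfo_max_embed] at e
      exact Sum.inl.inj e
    · rw [rnrInfo_min_embed, rnrInfo_min_embed] at e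
      exact (Prod.mk.inj (Sum.inr.inj e)).2
  util := fun i l => G.util i (strip l)

section

variable {G : Game A ι} {p : ℝ} {hp : p ∈ Set.Icc (0 : ℝ) 1}

/-- A strategy of the maximizer in the modified game, used in the original game. -/
def toOriginal (σ : (G.rnr p hp).Strategy .max) : G.Strategy .max where
  prob I a := σ.prob (Sum.inl I) (Sum.inr a)
  nonneg := by
    intro h hh ht a ha
    have h1 := σ.nonneg (embed true h) ((G.embed_mem_rnrHist true h).2 hh)
      ((G.rnrTurn_embed true h).trans ht) (Sum.inr a) (by
        change _ ∈ availIn G.rnrHist _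
        rw [availIn_embed]
        exact Finset.mem_map_of_mem _ ha)
    change 0 ≤ σ.prob (G.rnrInfo .max _) _ at h1
    rwa [rnrInfo_max_embed] at h1
  sum_eq_one := by
    intro h hh ht
    have h1 := σ.sum_eq_one (embed true h) ((G.embed_mem_rnrHist true h).2 hh)
      ((G.rnrTurn_embed true h).trans ht)
    change ∑ a ∈ availIn G.rnrHist _, σ.prob (G.rnrInfo .max _) _ = 1 at h1
    rwa [rnrInfo_max_embed, availIn_embed, Finset.sum_map] at h1

/-- The strategy of the minimizer in the modified game that follows the model `σF` in the copy
`true` and plays `τ` in the copy `false`. -/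
def withModel (σF τ : G.Strategy .min) : (G.rnr p hp).Strategy .min where
  prob
    | .inr (c, I), .inr a => (if c then σF else τ).prob I a
    | _, _ => 0
  nonneg := by
    intro l hl ht x hx
    change _ ∈ G.rnrHist at hl
    change G.rnrTurn _ = _ at ht
    change _ ∈ availIn G.rnrHist _ at hx
    rcases (G.mem_rnrHist l).1 hl with rfl | ⟨c, h, hh, rfl⟩
    · simp [rnrTurn] at ht
    rw [rnrTurn_embed] at ht
    rw [availIn_embed, Finset.mem_map] at hx
    obtain ⟨a, ha, rfl⟩ := hx
    change 0 ≤ (match G.rnrInfo .min (embed c h), (Sum.inr a : Bool ⊕ A) with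
      | .inr (c, I), .inr a => (if c then σF else τ).prob I a
      | _, _ => 0)
    rw [rnrInfo_min_embed]
    exact (if c then σF else τ).nonneg h hh ht a ha
  sum_eq_one := by
    intro l hl ht
    change _ ∈ G.rnrHist at hl
    change G.rnrTurn _ = _ at ht
    rcases (G.mem_rnrHist l).1 hl with rfl | ⟨c, h, hh, rfl⟩
    · simp [rnrTurn] at ht
    rw [rnrTurn_embed] at ht
    change ∑ x ∈ availIn G.rnrHist (embed c h),
      (match G.rnrInfo .min (embed c h), x with
      | .inr (c, I), .inr a => (if c then σF else τ).prob I a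
      | _, _ => 0) = 1
    rw [rnrInfo_min_embed, availIn_embed, Finset.sum_map]
    exact (if c then σF else τ).sum_eq_one h hh ht

/-- `u(σ, BR(σ))^T_V` for the maximizer in the modified game: the minimizer follows the model in the
copy `true`, responds to `σ` as well as possible in the copy `false`, and the value function `V` is
used below the trunk `T`. As the game is zero-sum, a best response minimizes the utility of the
maximizer. -/
noncomputable def worstUtil (pub : List (Bool ⊕ A) → κ)
    (V : ValueFn (Bool ⊕ A) (ι ⊕ (Bool × ι)) κ) (σF : G.Strategy .min)
    (T : Finset (List (Bool ⊕ A))) (σ : (G.rnr p hp).Strategy .max) : ℝ :=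
  ⨅ τ : G.Strategy .min, (G.rnr p hp).trunkUtil pub V T .max (profile σ (withModel σF τ))

/-- `σ` is a continual depth-limited restricted Nash response to the model `σF`, computed with the
value function `V` and with regret at most `ε` in each step: in step `k + 1` the strategy is fixed
on the previous trunk, and what it adds on the new subgame maximizes, up to `ε`, the utility in the
enlarged trunk against a best response. -/
def IsCDRNR (P : (G.rnr p hp).SubgamePartitioning κ)
    (V : ValueFn (Bool ⊕ A) (ι ⊕ (Bool × ι)) κ) (σF : G.Strategy .min) (ε : ℝ)
    (σ : (G.rnr p hp).Strategy .max) : Prop :=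
  ∀ k < P.n, ∀ τ : (G.rnr p hp).Strategy .max, τ.AgreeOn σ (P.trunk k) →
    worstUtil P.pub V σF (P.trunk (k + 1)) τ ≤ worstUtil P.pub V σF (P.trunk (k + 1)) σ + ε

end

end Game

/-!
The proof rests on two observations.

*One step of the response loses little.* Let `u^{T_k}` be the maximizer's utility in the trunk
`T_k`, evaluated with the exact value function at the depth limit. In the modified game, keep the
strategy of the maximizer fixed on `T_k` and let the minimizer follow the model on the part of
`T_k` in the model copy, both players being free otherwise. If the maximizer knows the strategy of
the minimizer, equilibrium strategies of the subgames below `T_k` give him what the worst case of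
`u^{T_k}` promises (`SubgamePartitioning.IsOptimal.exists_max_strategy`). By the minimax theorem
for such constrained strategies (`PerfectRecall.minimax`, from Sion's theorem for realization
plans) one strategy guarantees this against all of them. In the trunk `T_{k+1}` the value function
does not show less for it, since the minimizer can realize its values by equilibrium strategies
below `T_{k+1}` (`SubgamePartitioning.IsOptimal.exists_min_strategy`). Since the reach
probabilities at a depth limit sum to at most one, replacing `V` by its approximation costs at
most `εV` for each of the two trunks involved, so that the worst case drops by at most `2 * εV +
εR` from one step to the next (`worstUtil_step`). A Nash equilibrium strategy of the original game
plays the role of the guarantee in the first step, and in the last trunk, where no value function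
is used, the worst case over responses is at most the payoff against the model itself. Altogether
at most `2 * (n - 1) * εV + n * εR` is lost.

*The counting terms cover this loss.* The subgame added in each of the steps `2, …, n` contains
the histories of some public state at the previous depth limit. These `n - 1` public states are
distinct, as trunks are closed under public states; each of them lies directly below one of the
earlier subgames and contains an information set of each player
(`SubgamePartitioning.two_mul_le_sum_infoCount_borderB`). Hence the sum of the `|I_{S^B}|` alone
is at least `2 * (n - 1)`, and the terms with `|I_{S^O}|` need only be nonnegative.
-/

/-! ### Products along paths -/

theorem pathProd_append {A : Type*} (f : List A → A → ℝ) (g t t' : List A) :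
    pathProd f g (t ++ t') = pathProd f g t * pathProd f (g ++ t) t' := by
  induction t generalizing g with
  | nil => simp [pathProd]
  | cons a t ih => simp [pathProd, ih, mul_assoc]

theorem pathProd_congr {A : Type*} (f f' : List A → A → ℝ) (g t : List A)
    (h : ∀ u a, u ++ [a] <+: t → f (g ++ u) a = f' (g ++ u) a) :
    pathProd f g t = pathProd f' g t := by
  induction t generalizing g with
  | nil => rfl
  | cons a t ih =>
    simp only [pathProd]
    rw [ih]
    · rw [show f g a = f' g a by simpa using h [] a (by simp)]
    · intro u b hu
      have := h (a :: u) b (by simpa using hu)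
      simpa using this

theorem pathProd_nonneg {A : Type*} (f : List A → A → ℝ) (g t : List A)
    (h : ∀ u a, u ++ [a] <+: t → 0 ≤ f (g ++ u) a) : 0 ≤ pathProd f g t := by
  induction t generalizing g with
  | nil => simp [pathProd]
  | cons a t ih =>
    simp only [pathProd]
    refine mul_nonneg (by simpa using h [] a (by simp)) (ih _ ?_)
    intro u b hu
    have := h (a :: u) b (by simpa using hu)
    simpa using this

namespace Game

variable {A ι κ : Type*} [Fintype A]

/-! ### Histories, leaves and depth limits -/

theorem mem_avail {G : Game A ι} {h : List A} {a : A} : a ∈ G.avail h ↔ h ++ [a] ∈ G.hist := by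
  simp [avail, availIn]

theorem mem_terminals {G : Game A ι} {z : List A} :
    z ∈ G.terminals ↔ z ∈ G.hist ∧ G.avail z = ∅ := by
  simp [terminals]

theorem mem_hist_of_prefix {G : Game A ι} {g h : List A} (hh : h ∈ G.hist) (hg : g <+: h) :
    g ∈ G.hist := by
  obtain ⟨t, rfl⟩ := hg
  induction t using List.reverseRecOn with
  | nil => simpa using hh
  | append_singleton t a ih => exact ih (G.prefix_mem _ a (by simpa using hh))

theorem mem_border {G : Game A ι} {T : Finset (List A)} {h : List A} :
    h ∈ G.border T ↔ h ∈ G.hist ∧ h ∉ T ∧ (h = [] ∨ h.dropLast ∈ T) := by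
  simp [border]

theorem border_hist (G : Game A ι) : G.border G.hist = ∅ := by
  ext h
  simp only [mem_border, Finset.notMem_empty, iff_false]
  tauto

theorem exists_border_prefix {G : Game A ι} {T : Finset (List A)} {h : List A} (hh : h ∈ G.hist)
    (hT : h ∉ T) : ∃ b ∈ G.border T, b <+: h := by
  induction h using List.reverseRecOn with
  | nil => exact ⟨[], mem_border.2 ⟨hh, hT, Or.inl rfl⟩, List.prefix_refl _⟩
  | append_singleton t a ih =>
    by_cases ht : t ∈ T
    · exact ⟨t ++ [a], mem_border.2 ⟨hh, hT, Or.inr (by simpa using ht)⟩, List.prefix_refl _⟩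
    · obtain ⟨b, hb, hbt⟩ := ih (G.prefix_mem _ a hh) ht
      exact ⟨b, hb, hbt.trans (List.prefix_append _ _)⟩

theorem prefix_dropLast_of_ne {B : Type*} {g h : List B} (hg : g <+: h) (hne : g ≠ h) :
    g <+: h.dropLast := by
  obtain ⟨t, rfl⟩ := hg
  rcases List.eq_nil_or_concat' t with rfl | ⟨s, a, rfl⟩
  · simp at hne
  · rw [← List.append_assoc, List.dropLast_concat]
    exact List.prefix_append _ _

theorem IsTrunk.mem_of_border_of_prefix {G : Game A ι} {pub : List A → κ} {T : Finset (List A)}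
    (hT : G.IsTrunk pub T) {b g : List A} (hb : b ∈ G.border T) (hg : g <+: b) (hne : g ≠ b) :
    g ∈ T := by
  rcases (mem_border.1 hb).2.2 with rfl | h
  · exact absurd (List.prefix_nil.1 hg) hne
  · exact hT.2.1 _ h _ (prefix_dropLast_of_ne hg hne)

theorem IsTrunk.border_prefix_unique {G : Game A ι} {pub : List A → κ} {T : Finset (List A)}
    (hT : G.IsTrunk pub T) {b b' h : List A} (hb : b ∈ G.border T) (hb' : b' ∈ G.border T)
    (h1 : b <+: h) (h2 : b' <+: h) : b = b' := by
  by_contra hne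
  rcases List.prefix_or_prefix_of_prefix h1 h2 with h | h
  · exact (mem_border.1 hb).2.1 (hT.mem_of_border_of_prefix hb' h hne)
  · exact (mem_border.1 hb').2.1 (hT.mem_of_border_of_prefix hb h (Ne.symm hne))

theorem IsTrunk.notMem_of_border_prefix {G : Game A ι} {pub : List A → κ} {T : Finset (List A)}
    (hT : G.IsTrunk pub T) {b h : List A} (hb : b ∈ G.border T) (h1 : b <+: h) : h ∉ T :=
  fun h2 => (mem_border.1 hb).2.1 (hT.2.1 _ h2 _ h1)

/-! ### Reach probabilities -/

section reach

variable {G : Game A ι}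

theorem reach_append (σ : G.Profile) (g t : List A) :
    G.reach σ (g ++ t) = G.reach σ g * pathProd (G.stepProb σ) g t := by
  simp [reach, pathProd_append]

/-- The entries of `H_i(h)` are actions available at information sets of player `i`. -/
theorem exists_of_mem_ownSeqFrom {i : Player} {g t : List A} (h : g ++ t ∈ G.hist) {x : ι × A}
    (hx : x ∈ G.ownSeqFrom i g t) :
    ∃ g' ∈ G.hist, G.turn g' = some i ∧ G.info i g' = x.1 ∧ x.2 ∈ G.avail g' := by
  induction t generalizing g with
  | nil => simp [ownSeqFrom] at hx
  | cons a t ih =>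
    have h' : g ++ [a] ++ t ∈ G.hist := by simpa using h
    have ha : g ++ [a] ∈ G.hist := mem_hist_of_prefix h' (List.prefix_append _ _)
    simp only [ownSeqFrom] at hx
    split_ifs at hx with ht
    · rcases List.mem_cons.1 hx with rfl | hx
      · exact ⟨g, G.prefix_mem _ _ ha, ht, rfl, mem_avail.2 ha⟩
      · exact ih h' hx
    · exact ih h' hx

theorem ownReach_nonneg {i : Player} (σ : G.Strategy i) {h : List A} (hh : h ∈ G.hist) :
    0 ≤ ownReach σ (G.augInfo i h) := by
  apply List.prod_nonneg
  intro x hx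
  obtain ⟨y, hy, rfl⟩ := List.mem_map.1 hx
  obtain ⟨g, hg, ht, e, ha⟩ := exists_of_mem_ownSeqFrom (g := []) hh hy
  rw [← e]
  exact σ.nonneg g hg ht _ ha

theorem stepProb_nonneg (σ : G.Profile) {g : List A} {a : A} (h : g ++ [a] ∈ G.hist) :
    0 ≤ G.stepProb σ g a := by
  have hg := G.prefix_mem _ _ h
  unfold stepProb
  rcases ht : G.turn g with _ | i
  · exact G.chance_nonneg g hg ht a (mem_avail.2 h)
  · exact (σ i).nonneg g hg ht a (mem_avail.2 h)

theorem reach_nonneg (σ : G.Profile) {h : List A} (hh : h ∈ G.hist) : 0 ≤ G.reach σ h := by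
  apply pathProd_nonneg
  intro u a hu
  exact stepProb_nonneg σ (by simpa using mem_hist_of_prefix hh hu)

theorem stepProb_sum (σ : G.Profile) {g : List A} (hg : g ∈ G.hist) (h0 : G.avail g ≠ ∅) :
    ∑ a ∈ G.avail g, G.stepProb σ g a = 1 := by
  unfold stepProb
  rcases ht : G.turn g with _ | i
  · exact G.chance_sum g hg ht h0
  · exact (σ i).sum_eq_one g hg ht

theorem pathProd_stepProb_eq (σ : G.Profile) (g t : List A) :
    pathProd (G.stepProb σ) g t =
      ((G.ownSeqFrom .max g t).map fun x => (σ .max).prob x.1 x.2).prod *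
      ((G.ownSeqFrom .min g t).map fun x => (σ .min).prob x.1 x.2).prod *
      pathProd (fun g a => match G.turn g with
        | none => G.chance g a
        | some _ => 1) g t := by
  induction t generalizing g with
  | nil => simp [pathProd, ownSeqFrom]
  | cons a t ih =>
    simp only [pathProd, ownSeqFrom, ih, stepProb]
    rcases ht : G.turn g with _ | i
    · simp; ring
    · cases i <;> simp <;> ring

theorem reach_eq (σ : G.Profile) (h : List A) :
    G.reach σ h = ownReach (σ .max) (G.augInfo .max h) * ownReach (σ .min) (G.augInfo .min h) *
      G.chanceReach h :=
  pathProd_stepProb_eq σ [] h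

open Classical in
/-- Play that starts at a history ends in a leaf with probability one. -/
theorem sum_pathProd_terminals (σ : G.Profile) {h : List A} (hh : h ∈ G.hist) :
    ∑ z ∈ G.terminals.filter (fun z => h <+: z),
      pathProd (G.stepProb σ) h (z.drop h.length) = 1 := by
  -- Induction on a bound `n` for the length of the continuations of `h`.
  suffices H : ∀ n, ∀ h ∈ G.hist, G.hist.sup List.length ≤ h.length + n →
      ∑ z ∈ G.terminals.filter (fun z => h <+: z),
        pathProd (G.stepProb σ) h (z.drop h.length) = 1 from
    H _ h hh (Nat.le_add_left _ _)
  intro n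
  induction n with
  | zero =>
    intro h hh hn
    have h0 : G.terminals.filter (fun z => h <+: z) = {h} := by
      ext z
      simp only [Finset.mem_filter, mem_terminals, Finset.mem_singleton]
      constructor
      · rintro ⟨⟨hz, -⟩, hp⟩
        have : z.length ≤ G.hist.sup List.length := Finset.le_sup (f := List.length) hz
        exact (hp.eq_of_length_le (by omega)).symm
      · rintro rfl
        refine ⟨⟨hh, ?_⟩, List.prefix_refl _⟩
        rw [Finset.eq_empty_iff_forall_notMem]
        intro a ha
        have := Finset.le_sup (f := List.length) (mem_avail.1 ha)
        simp only [List.length_append, List.length_singleton] at this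
        omega
    rw [h0]
    simp [pathProd]
  | succ n ih =>
    intro h hh hn
    by_cases h0 : G.avail h = ∅
    · have h1 : G.terminals.filter (fun z => h <+: z) = {h} := by
        ext z
        simp only [Finset.mem_filter, mem_terminals, Finset.mem_singleton]
        constructor
        · rintro ⟨⟨hz, -⟩, t, rfl⟩
          rcases t with _ | ⟨a, t⟩
          · simp
          · have : a ∈ G.avail h := mem_avail.2 (mem_hist_of_prefix hz ⟨t, by simp⟩)
            simp [h0] at this
        · rintro rfl
          exact ⟨⟨hh, h0⟩, List.prefix_refl _⟩
      rw [h1]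
      simp [pathProd]
    · have h1 : G.terminals.filter (fun z => h <+: z) =
          (G.avail h).biUnion fun a => G.terminals.filter (fun z => h ++ [a] <+: z) := by
        ext z
        simp only [Finset.mem_filter, mem_terminals, Finset.mem_biUnion]
        constructor
        · rintro ⟨⟨hz, hz0⟩, t, rfl⟩
          rcases t with _ | ⟨a, t⟩
          · simp only [List.append_nil] at hz0
            exact absurd hz0 h0
          · have hp : h ++ [a] <+: h ++ a :: t := ⟨t, by simp⟩
            exact ⟨a, mem_avail.2 (mem_hist_of_prefix hz hp), ⟨hz, hz0⟩, hp⟩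
        · rintro ⟨a, -, hz, hp⟩
          exact ⟨hz, (List.prefix_append _ _).trans hp⟩
      rw [h1, Finset.sum_biUnion]
      · rw [← stepProb_sum σ hh h0]
        refine Finset.sum_congr rfl fun a ha => ?_
        have h2 := ih (h ++ [a]) (mem_avail.1 ha) (by
          rw [List.length_append, List.length_singleton]
          omega)
        rw [← mul_one (G.stepProb σ h a), ← h2, Finset.mul_sum]
        refine Finset.sum_congr rfl fun z hz => ?_
        obtain ⟨t, rfl⟩ := (Finset.mem_filter.1 hz).2
        rw [List.drop_left, List.append_assoc, List.drop_left]
        rfl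
      · intro a _ b _ hab
        refine Finset.disjoint_left.2 fun z hz hz' => hab ?_
        obtain ⟨t, rfl⟩ := (Finset.mem_filter.1 hz).2
        obtain ⟨t', e⟩ := (Finset.mem_filter.1 hz').2
        simp only [List.append_assoc, List.singleton_append, List.append_cancel_left_eq,
          List.cons.injEq] at e
        exact e.1.symm

open Classical in
/-- The leaves of the game are those in the trunk and those below exactly one history at its depth
limit. -/
theorem sum_terminals_eq {pub : List A → κ} {T : Finset (List A)} (hT : G.IsTrunk pub T)
    (σ : G.Profile) (φ : List A → ℝ) :
    ∑ z ∈ G.terminals, φ z * G.reach σ z =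
      ∑ z ∈ G.terminals.filter (fun z => z ∈ T), φ z * G.reach σ z +
      ∑ h ∈ G.border T, G.reach σ h * ∑ z ∈ G.terminals.filter (fun z => h <+: z),
        pathProd (G.stepProb σ) h (z.drop h.length) * φ z := by
  rw [← Finset.sum_filter_add_sum_filter_not G.terminals (fun z => z ∈ T)]
  congr 1
  have h1 : G.terminals.filter (fun z => z ∉ T) =
      (G.border T).biUnion fun h => G.terminals.filter (fun z => h <+: z) := by
    ext z
    simp only [Finset.mem_filter, Finset.mem_biUnion]
    constructor
    · rintro ⟨hz, hzT⟩
      obtain ⟨b, hb, hbz⟩ := exists_border_prefix (mem_terminals.1 hz).1 hzT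
      exact ⟨b, hb, hz, hbz⟩
    · rintro ⟨b, hb, hz, hbz⟩
      exact ⟨hz, hT.notMem_of_border_prefix hb hbz⟩
  rw [h1, Finset.sum_biUnion]
  · refine Finset.sum_congr rfl fun h _ => ?_
    rw [Finset.mul_sum]
    refine Finset.sum_congr rfl fun z hz => ?_
    obtain ⟨t, rfl⟩ := (Finset.mem_filter.1 hz).2
    rw [List.drop_left, reach_append]
    ring
  · intro a ha b hb hab
    refine Finset.disjoint_left.2 fun z hz hz' => hab ?_
    exact hT.border_prefix_unique ha hb (Finset.mem_filter.1 hz).2 (Finset.mem_filter.1 hz').2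

open Classical in
theorem utility_eq_trunk_add {pub : List A → κ} {T : Finset (List A)} (hT : G.IsTrunk pub T)
    (i : Player) (σ : G.Profile) :
    G.utility i σ = ∑ z ∈ G.terminals.filter (fun z => z ∈ T), G.util i z * G.reach σ z +
      ∑ h ∈ G.border T, G.reach σ h * G.contUtil i σ h :=
  sum_terminals_eq hT σ (G.util i)

theorem sum_reach_terminals (G : Game A ι) (σ : G.Profile) :
    ∑ z ∈ G.terminals, G.reach σ z = 1 := by
  classical
  have h := sum_pathProd_terminals σ G.nil_mem
  rwa [Finset.filter_true_of_mem fun z _ => List.nil_prefix] at h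

theorem sum_reach_border_le_one {pub : List A → κ} {T : Finset (List A)} (hT : G.IsTrunk pub T)
    (σ : G.Profile) : ∑ h ∈ G.border T, G.reach σ h ≤ 1 := by
  classical
  have h1 := sum_terminals_eq hT σ (fun _ => 1)
  simp only [one_mul, mul_one, sum_reach_terminals] at h1
  have h3 : ∑ h ∈ G.border T, G.reach σ h * ∑ z ∈ G.terminals.filter (fun z => h <+: z),
      pathProd (G.stepProb σ) h (z.drop h.length) = ∑ h ∈ G.border T, G.reach σ h :=
    Finset.sum_congr rfl fun h hh => by
      rw [sum_pathProd_terminals σ (mem_border.1 hh).1, mul_one]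
  rw [h3] at h1
  have h4 : 0 ≤ ∑ z ∈ G.terminals.filter (fun z => z ∈ T), G.reach σ z :=
    Finset.sum_nonneg fun z hz =>
      reach_nonneg σ (mem_terminals.1 (Finset.mem_filter.1 hz).1).1
  linarith

/-- Utilities are averages over the leaves. -/
theorem neg_sum_abs_le_utility (G : Game A ι) (i : Player) (σ : G.Profile) :
    -∑ z ∈ G.terminals, |G.util i z| ≤ G.utility i σ := by
  rw [← mul_one (-∑ z ∈ G.terminals, |G.util i z|), ← sum_reach_terminals G σ, Finset.mul_sum,
    utility]
  refine Finset.sum_le_sum fun z hz => mul_le_mul_of_nonneg_right ?_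
    (reach_nonneg σ (mem_terminals.1 hz).1)
  exact (neg_le_neg (Finset.single_le_sum (f := fun z => |G.util i z|)
    (fun z _ => abs_nonneg _) hz)).trans (neg_abs_le _)

theorem utility_min_eq_neg (hz : G.IsZeroSum) (σ : G.Profile) :
    G.utility .min σ = - G.utility .max σ := by
  rw [utility, utility, ← Finset.sum_neg_distrib]
  refine Finset.sum_congr rfl fun z h => ?_
  have := hz z h
  rw [show G.util .min z = - G.util .max z by linarith]
  ring

theorem contUtil_min_eq_neg (hz : G.IsZeroSum) (σ : G.Profile) (h : List A) :
    G.contUtil .min σ h = - G.contUtil .max σ h := by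
  classical
  rw [contUtil, contUtil, ← Finset.sum_neg_distrib]
  refine Finset.sum_congr rfl fun z h => ?_
  have := hz z (Finset.mem_filter.1 h).1
  rw [show G.util .min z = - G.util .max z by linarith]
  ring

theorem contUtil_congr (i : Player) (σ σ' : G.Profile) (h : List A)
    (H : ∀ g a, h <+: g → g ++ [a] ∈ G.hist → G.stepProb σ g a = G.stepProb σ' g a) :
    G.contUtil i σ h = G.contUtil i σ' h := by
  classical
  refine Finset.sum_congr rfl fun z hz => ?_
  obtain ⟨t, rfl⟩ := (Finset.mem_filter.1 hz).2
  rw [List.drop_left]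
  congr 1
  refine pathProd_congr _ _ _ _ fun u a hu => H _ _ (List.prefix_append _ _) ?_
  refine mem_hist_of_prefix (mem_terminals.1 (Finset.mem_filter.1 hz).1).1 ?_
  rw [List.append_assoc]
  exact (List.prefix_append_right_inj _).2 hu

theorem reach_congr (σ σ' : G.Profile) (h : List A)
    (H : ∀ g a, g ++ [a] <+: h → G.stepProb σ g a = G.stepProb σ' g a) :
    G.reach σ h = G.reach σ' h :=
  pathProd_congr _ _ _ _ fun u a hu => by simpa using H u a hu

theorem Strategy.AgreeOn.mono {i : Player} {σ τ : G.Strategy i} {T T' : Finset (List A)}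
    (h : σ.AgreeOn τ T) (hT : T' ⊆ T) : σ.AgreeOn τ T' :=
  fun g hg => h g (hT hg)

theorem Strategy.AgreeOn.refl {i : Player} (σ : G.Strategy i) (T : Finset (List A)) :
    σ.AgreeOn σ T := fun _ _ _ _ _ => rfl

/-- Profiles that agree on a trunk reach its histories, and the histories right below it, with the
same probability. -/
theorem reach_eq_of_agreeOn {pub : List A → κ} {T : Finset (List A)} (hT : G.IsTrunk pub T)
    {σ σ' : G.Profile} (H : ∀ i, (σ i).AgreeOn (σ' i) T) {h : List A}
    (hh : h ∈ T ∨ h ∈ G.border T) : G.reach σ h = G.reach σ' h := by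
  have hhist : h ∈ G.hist := hh.elim (fun h1 => hT.1 h1) fun h1 => (mem_border.1 h1).1
  refine reach_congr _ _ _ fun g a hg => ?_
  have hgh : g ++ [a] ∈ G.hist := mem_hist_of_prefix hhist hg
  have hgT : g ∈ T := by
    have hp : g <+: h := (List.prefix_append _ _).trans hg
    rcases hh with h1 | h1
    · exact hT.2.1 _ h1 _ hp
    · refine hT.mem_of_border_of_prefix h1 hp ?_
      rintro rfl
      have := hg.length_le
      simp at this
  unfold stepProb
  rcases ht : G.turn g with _ | i
  · rfl
  · exact H i g hgT ht a (mem_avail.2 hgh)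

end reach

/-! ### Public states at a depth limit -/

theorem PerfectRecall.augInfo_eq {G : Game A ι} (hG : G.PerfectRecall) {i : Player} {h h' : List A}
    (hh : h ∈ G.hist) (hh' : h' ∈ G.hist) (ht : G.turn h = some i) (ht' : G.turn h' = some i)
    (e : G.info i h = G.info i h') : G.augInfo i h = G.augInfo i h' := by
  simp [augInfo, ht, ht', e, hG i h hh h' hh' ht ht' e]

namespace SubgamePartitioning

variable {G : Game A ι} (P : G.SubgamePartitioning κ)

theorem trunk_mono {j k : ℕ} (hjk : j ≤ k) (hk : k ≤ P.n) : P.trunk j ⊆ P.trunk k := by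
  induction k, hjk using Nat.le_induction with
  | base => exact Finset.Subset.refl _
  | succ k _ ih => exact (ih (by omega)).trans (P.trunk_ssubset k (by omega)).1

theorem mem_trunk_iff {k : ℕ} (hk : k ≤ P.n) {h h' : List A} (hh : h ∈ G.hist)
    (hh' : h' ∈ G.hist) (e : P.pub h = P.pub h') : h ∈ P.trunk k ↔ h' ∈ P.trunk k :=
  ⟨fun h1 => (P.isTrunk k hk).2.2 h h1 h' hh' e.symm,
    fun h1 => (P.isTrunk k hk).2.2 h' h1 h hh e⟩

/-- What lies below the depth limit in one public state lies below one public state of the depth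
limit. -/
theorem pub_border_eq {k : ℕ} (hk : k ≤ P.n) {h h' b b' : List A} (hh : h ∈ G.hist)
    (hh' : h' ∈ G.hist) (e : P.pub h = P.pub h') (hb : b ∈ G.border (P.trunk k))
    (hb' : b' ∈ G.border (P.trunk k)) (hbh : b <+: h) (hbh' : b' <+: h') : P.pub b = P.pub b' := by
  obtain ⟨-, b'', hb'', e1, hp⟩ := (P.isSubgame k hk (P.pub b)).2.2 h ⟨hh, b, hb, rfl, hbh⟩ h' hh'
    e.symm
  rw [← e1, (P.isTrunk k hk).border_prefix_unique hb'' hb' hp hbh']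

theorem mem_roots_iff {k : ℕ} (hk : k ≤ P.n) {b : List A} (hb : b ∈ G.border (P.trunk k))
    (h : List A) :
    h ∈ G.roots P.pub (P.pub b) ↔ h ∈ G.border (P.trunk k) ∧ P.pub h = P.pub b := by
  simp only [roots, Finset.mem_filter]
  constructor
  · rintro ⟨hh, e, hmin⟩
    refine ⟨?_, e⟩
    obtain ⟨-, b', hb', e', hp⟩ := (P.isSubgame k hk (P.pub b)).2.2 b
      ⟨(mem_border.1 hb).1, b, hb, rfl, List.prefix_refl _⟩ h hh e
    by_cases hne : b' = h
    · exact hne ▸ hb'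
    · exact absurd e' (hmin b' hp hne)
  · rintro ⟨hh, e⟩
    refine ⟨(mem_border.1 hh).1, e, fun g hg hne eg => ?_⟩
    have hgT := (P.isTrunk k hk).mem_of_border_of_prefix hh hg hne
    exact (mem_border.1 hb).2.1
      ((P.mem_trunk_iff hk (mem_hist_of_prefix (mem_border.1 hh).1 hg)
        (mem_border.1 hb).1 eg).1 hgT)

open Classical in
theorem sum_border_eq {k : ℕ} (hk : k ≤ P.n) (f : List A → ℝ) :
    ∑ h ∈ G.border (P.trunk k), f h =
      ∑ c ∈ (G.border (P.trunk k)).image P.pub, ∑ h ∈ G.roots P.pub c, f h := by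
  rw [← Finset.sum_fiberwise_of_maps_to (g := P.pub) (t := (G.border (P.trunk k)).image P.pub)
    (fun h hh => Finset.mem_image_of_mem _ hh)]
  refine Finset.sum_congr rfl fun c hc => ?_
  obtain ⟨b, hb, rfl⟩ := Finset.mem_image.1 hc
  refine Finset.sum_congr ?_ fun _ _ => rfl
  ext h
  rw [P.mem_roots_iff hk hb, Finset.mem_filter]

end SubgamePartitioning

/-! ### Ranges -/

section ranges

variable {G : Game A ι}

open Classical in
theorem sum_roots_eq (G : Game A ι) (pub : List A → κ) (i : Player) (c : κ) (f : List A → ℝ) :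
    ∑ h ∈ G.roots pub c, f h = ∑ I ∈ G.pubInfos pub i c,
      ∑ h ∈ (G.roots pub c).filter (fun h => G.augInfo i h = I), f h :=
  (Finset.sum_fiberwise_of_maps_to
    (fun _ hh => Finset.mem_image_of_mem (G.augInfo i) hh) f).symm

theorem mem_hist_of_mem_roots {pub : List A → κ} {c : κ} {h : List A} (hh : h ∈ G.roots pub c) :
    h ∈ G.hist := by
  classical
  exact (Finset.mem_filter.1 hh).1

theorem augInfo_mem_pubInfos {pub : List A → κ} {c : κ} {h : List A} (hh : h ∈ G.roots pub c)
    (i : Player) : G.augInfo i h ∈ G.pubInfos pub i c := by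
  classical
  exact Finset.mem_image_of_mem _ hh

/-- The total own reach probability of player `i` over his information sets at the roots of the
public state `c`: the constant by which a range has to be multiplied to give reach probabilities. -/
noncomputable def rangeMass (G : Game A ι) (pub : List A → κ) (σ : G.Profile) (c : κ)
    (i : Player) : ℝ :=
  ∑ J ∈ G.pubInfos pub i c, ownReach (σ i) J

theorem ownReach_nonneg_of_mem_pubInfos {pub : List A → κ} {c : κ} {i : Player}
    (σ : G.Strategy i) {I : AugInfo A ι} (hI : I ∈ G.pubInfos pub i c) : 0 ≤ ownReach σ I := by
  classical
  obtain ⟨h, hh, rfl⟩ := Finset.mem_image.1 hI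
  exact ownReach_nonneg σ (mem_hist_of_mem_roots hh)

theorem rangeMass_nonneg (pub : List A → κ) (σ : G.Profile) (c : κ) (i : Player) :
    0 ≤ G.rangeMass pub σ c i :=
  Finset.sum_nonneg fun _ hJ => ownReach_nonneg_of_mem_pubInfos (σ i) hJ

theorem rangeMass_mul_ranges {pub : List A → κ} (σ : G.Profile) {c : κ} {i : Player}
    {I : AugInfo A ι} (hI : I ∈ G.pubInfos pub i c) :
    G.rangeMass pub σ c i * G.ranges pub σ c i I = ownReach (σ i) I := by
  rw [ranges, if_pos hI]
  change G.rangeMass pub σ c i * (_ / G.rangeMass pub σ c i) = _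
  by_cases h0 : G.rangeMass pub σ c i = 0
  · rw [h0, zero_mul]
    exact ((Finset.sum_eq_zero_iff_of_nonneg
      fun _ hJ => ownReach_nonneg_of_mem_pubInfos (σ i) hJ).1 h0 I hI).symm
  · field_simp

theorem isRanges_ranges {pub : List A → κ} {σ : G.Profile} {c : κ}
    (h0 : ∀ i, G.rangeMass pub σ c i ≠ 0) : G.IsRanges pub c (G.ranges pub σ c) := by
  intro i
  refine ⟨fun I => ?_, fun I hI => by rw [ranges, if_neg hI], ?_⟩
  · by_cases hI : I ∈ G.pubInfos pub i c
    · rw [ranges, if_pos hI]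
      exact div_nonneg (ownReach_nonneg_of_mem_pubInfos (σ i) hI) (G.rangeMass_nonneg pub σ c i)
    · rw [ranges, if_neg hI]
  · have h1 : ∑ I ∈ G.pubInfos pub i c, G.ranges pub σ c i I =
        ∑ I ∈ G.pubInfos pub i c, ownReach (σ i) I / G.rangeMass pub σ c i :=
      Finset.sum_congr rfl fun I hI => by rw [ranges, if_pos hI]; rfl
    rw [h1, ← Finset.sum_div]
    exact div_self (h0 i)

theorem reach_eq_rangeMass_mul {pub : List A → κ} (σ : G.Profile) {c : κ} {h : List A}
    (hh : h ∈ G.roots pub c) :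
    G.reach σ h = G.rangeMass pub σ c .max * G.rangeMass pub σ c .min *
      (G.ranges pub σ c .max (G.augInfo .max h) * G.ranges pub σ c .min (G.augInfo .min h) *
        G.chanceReach h) := by
  rw [reach_eq, ← rangeMass_mul_ranges σ (augInfo_mem_pubInfos hh .max),
    ← rangeMass_mul_ranges σ (augInfo_mem_pubInfos hh .min)]
  ring

theorem isRanges_of_reach_ne_zero {pub : List A → κ} {σ : G.Profile} {c : κ} {h : List A}
    (hh : h ∈ G.roots pub c) (h0 : G.reach σ h ≠ 0) : G.IsRanges pub c (G.ranges pub σ c) := by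
  rw [reach_eq_rangeMass_mul σ hh] at h0
  refine isRanges_ranges fun i hi => h0 ?_
  cases i <;> simp [hi]

theorem sum_reach_mul_contUtil (pub : List A → κ) (σ ν : G.Profile) (c : κ) (i : Player) :
    ∑ h ∈ G.roots pub c, G.reach σ h * G.contUtil i ν h =
      G.rangeMass pub σ c .max * G.rangeMass pub σ c .min *
        G.subUtil pub c (G.ranges pub σ c) i ν := by
  rw [subUtil, Finset.mul_sum]
  refine Finset.sum_congr rfl fun h hh => ?_
  rw [reach_eq_rangeMass_mul σ hh]
  ring

/-- Conditional values of the information sets, weighted by their reach probabilities, give the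
unconditional expected utility. -/
theorem sum_reach_mul_value {pub : List A → κ} {σ ν : G.Profile} {c : κ} {i : Player}
    {v : AugInfo A ι → ℝ}
    (hv : ∀ I ∈ G.pubInfos pub i c, G.IsInfoValue pub c (G.ranges pub σ c) ν i I (v I)) :
    ∑ h ∈ G.roots pub c, G.reach σ h * v (G.augInfo i h) =
      ∑ h ∈ G.roots pub c, G.reach σ h * G.contUtil i ν h := by
  classical
  have key : ∀ h ∈ G.roots pub c, G.reach σ h =
      G.rangeMass pub σ c .max * G.rangeMass pub σ c .min *
        G.ranges pub σ c i (G.augInfo i h) * G.cfWeight (G.ranges pub σ c) i h := by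
    intro h hh
    rw [reach_eq_rangeMass_mul σ hh, cfWeight]
    cases i <;> simp only [Player.other] <;> ring
  rw [sum_roots_eq G pub i c, sum_roots_eq G pub i c]
  refine Finset.sum_congr rfl fun I hI => ?_
  have h1 := hv I hI
  rw [IsInfoValue] at h1
  set m := G.rangeMass pub σ c .max * G.rangeMass pub σ c .min * G.ranges pub σ c i I with hm
  have h2 := congrArg (m * ·) h1
  simp only [Finset.mul_sum] at h2
  convert h2 using 1
  · refine Finset.sum_congr rfl fun h hh => ?_
    obtain ⟨hr, rfl⟩ := Finset.mem_filter.1 hh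
    rw [key h hr, ← hm]
    ring
  · refine Finset.sum_congr rfl fun h hh => ?_
    obtain ⟨hr, rfl⟩ := Finset.mem_filter.1 hh
    rw [key h hr, ← hm]
    ring

end ranges

/-! ### Utilities in a trunk -/

namespace SubgamePartitioning

variable {G : Game A ι} (P : G.SubgamePartitioning κ)

theorem atDepthLimit {k : ℕ} (h1 : 1 ≤ k) (hk : k ≤ P.n) {b : List A}
    (hb : b ∈ G.border (P.trunk k)) : P.AtDepthLimit (P.pub b) :=
  ⟨k, h1, hk, b, hb, rfl⟩

open Classical in
theorem trunkUtil_eq {k : ℕ} (hk : k ≤ P.n) (V : ValueFn A ι κ) (i : Player) (σ : G.Profile) :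
    G.trunkUtil P.pub V (P.trunk k) i σ =
      (∑ z ∈ G.terminals.filter (fun z => z ∈ P.trunk k), G.util i z * G.reach σ z) +
      ∑ h ∈ G.border (P.trunk k),
        G.reach σ h * V (P.pub h) (G.ranges P.pub σ (P.pub h)) i (G.augInfo i h) := by
  rw [trunkUtil, P.sum_border_eq hk]
  congr 1
  refine Finset.sum_congr rfl fun c _ => ?_
  rw [sum_roots_eq G P.pub i c]
  refine Finset.sum_congr rfl fun I _ => ?_
  rw [Finset.sum_mul]
  refine Finset.sum_congr rfl fun h hh => ?_
  obtain ⟨hr, rfl⟩ := Finset.mem_filter.1 hh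
  rw [(Finset.mem_filter.1 hr).2.1]

/-- The values at a depth limit are weighted by reach probabilities, which sum to at most one, so
that an approximate value function changes utilities in a trunk by no more than its error. -/
theorem abs_trunkUtil_sub_le {V V' : ValueFn A ι κ} {ε : ℝ} (hV : P.ErrorLE V' V ε) (hε : 0 ≤ ε)
    {k : ℕ} (h1 : 1 ≤ k) (hk : k ≤ P.n) (i : Player) (σ : G.Profile) :
    |G.trunkUtil P.pub V' (P.trunk k) i σ - G.trunkUtil P.pub V (P.trunk k) i σ| ≤ ε := by
  rw [P.trunkUtil_eq hk, P.trunkUtil_eq hk, add_sub_add_left_eq_sub, ← Finset.sum_sub_distrib]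
  refine (Finset.abs_sum_le_sum_abs _ _).trans ?_
  have h2 : ∀ h ∈ G.border (P.trunk k),
      |G.reach σ h * V' (P.pub h) (G.ranges P.pub σ (P.pub h)) i (G.augInfo i h) -
        G.reach σ h * V (P.pub h) (G.ranges P.pub σ (P.pub h)) i (G.augInfo i h)| ≤
      G.reach σ h * ε := by
    intro h hh
    have h0 := reach_nonneg σ (mem_border.1 hh).1
    rw [← mul_sub, abs_mul, abs_of_nonneg h0]
    by_cases h3 : G.reach σ h = 0
    · simp [h3]
    · have hr : h ∈ G.roots P.pub (P.pub h) := (P.mem_roots_iff hk hh h).2 ⟨hh, rfl⟩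
      exact mul_le_mul_of_nonneg_left (hV _ (P.atDepthLimit h1 hk hh) _
        (isRanges_of_reach_ne_zero hr h3) i _ (augInfo_mem_pubInfos hr i)) h0
  refine (Finset.sum_le_sum h2).trans ?_
  rw [← Finset.sum_mul]
  exact mul_le_of_le_one_left hε (sum_reach_border_le_one (P.isTrunk k hk) σ)

theorem trunkUtil_last (V : ValueFn A ι κ) (i : Player) (σ : G.Profile) :
    G.trunkUtil P.pub V (P.trunk P.n) i σ = G.utility i σ := by
  rw [P.trunkUtil_eq le_rfl, utility_eq_trunk_add (P.isTrunk P.n le_rfl), P.trunk_last,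
    border_hist]
  simp

open Classical in
/-- A strategy can be put together from one for a trunk and one for each public state at its depth
limit, as no information set meets two of these parts of the game. -/
theorem exists_strategy_extending (hG : G.PerfectRecall) {k : ℕ} (hk : k ≤ P.n) {i : Player}
    (s₀ : G.Strategy i) (ν : κ → G.Strategy i) :
    ∃ s : G.Strategy i, s.AgreeOn s₀ (P.trunk k) ∧
      ∀ b ∈ G.border (P.trunk k), ∀ h ∈ G.hist, b <+: h → G.turn h = some i →
        ∀ a, s.prob (G.info i h) a = (ν (P.pub b)).prob (G.info i h) a := by
  -- `sel h` is the strategy to be used at `h`; it is the same throughout an information set.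
  let sel : List A → G.Strategy i := fun h =>
    if h ∈ P.trunk k then s₀ else
      if hb : ∃ b ∈ G.border (P.trunk k), b <+: h then ν (P.pub hb.choose) else s₀
  have sel_trunk : ∀ h ∈ P.trunk k, sel h = s₀ := fun h hh => if_pos hh
  have sel_border : ∀ b ∈ G.border (P.trunk k), ∀ h, b <+: h → sel h = ν (P.pub b) := by
    intro b hb h hbh
    have hex : ∃ b ∈ G.border (P.trunk k), b <+: h := ⟨b, hb, hbh⟩
    have : sel h = ν (P.pub hex.choose) := by
      simp only [sel]
      rw [if_neg ((P.isTrunk k hk).notMem_of_border_prefix hb hbh), dif_pos hex]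
    rw [this, (P.isTrunk k hk).border_prefix_unique hex.choose_spec.1 hb hex.choose_spec.2 hbh]
  have sel_eq : ∀ h ∈ G.hist, ∀ h' ∈ G.hist, G.turn h = some i → G.turn h' = some i →
      G.info i h = G.info i h' → sel h = sel h' := by
    intro h hh h' hh' ht ht' e
    have e' := P.isPublic i h hh h' hh' (hG.augInfo_eq hh hh' ht ht' e)
    by_cases hT : h ∈ P.trunk k
    · rw [sel_trunk h hT, sel_trunk h' ((P.mem_trunk_iff hk hh hh' e').1 hT)]
    · have hT' := fun h1 => hT ((P.mem_trunk_iff hk hh hh' e').2 h1)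
      obtain ⟨b, hb, hbh⟩ := exists_border_prefix hh hT
      obtain ⟨b', hb', hbh'⟩ := exists_border_prefix hh' hT'
      rw [sel_border b hb h hbh, sel_border b' hb' h' hbh',
        P.pub_border_eq hk hh hh' e' hb hb' hbh hbh']
  let prob : ι → A → ℝ := fun J a =>
    if hJ : ∃ h ∈ G.hist, G.turn h = some i ∧ G.info i h = J then (sel hJ.choose).prob J a else 0
  have prob_eq : ∀ h ∈ G.hist, G.turn h = some i → ∀ a,
      prob (G.info i h) a = (sel h).prob (G.info i h) a := by
    intro h hh ht a
    have hJ : ∃ h' ∈ G.hist, G.turn h' = some i ∧ G.info i h' = G.info i h := ⟨h, hh, ht, rfl⟩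
    simp only [prob]
    rw [dif_pos hJ, sel_eq _ hJ.choose_spec.1 h hh hJ.choose_spec.2.1 ht hJ.choose_spec.2.2]
  refine ⟨⟨prob, ?_, ?_⟩, ?_, ?_⟩
  · intro h hh ht a ha
    rw [prob_eq h hh ht]
    exact (sel h).nonneg h hh ht a ha
  · intro h hh ht
    simp only [prob_eq h hh ht]
    exact (sel h).sum_eq_one h hh ht
  · intro h hT ht a _
    rw [← sel_trunk h hT]
    exact prob_eq h ((P.isTrunk k hk).1 hT) ht a
  · intro b hb h hh hbh ht a
    rw [← sel_border b hb h hbh]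
    exact prob_eq h hh ht a

open Classical in
/-- If player `i` follows the trunk part of `σ` and equilibrium strategies of the subgames below,
then no play of the opponent below the trunk can push his utility below what these equilibria
promise. -/
theorem exists_strategy_secure (hz : G.IsZeroSum) (hG : G.PerfectRecall) {k : ℕ} (hk : k ≤ P.n)
    (σ : G.Profile) (ν : κ → G.Profile)
    (hν : ∀ b ∈ G.border (P.trunk k), G.IsRanges P.pub (P.pub b) (G.ranges P.pub σ (P.pub b)) →
      G.IsSubNash P.pub (P.pub b) (G.ranges P.pub σ (P.pub b)) (ν (P.pub b)))
    (i : Player) :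
    ∃ s : G.Strategy i, s.AgreeOn (σ i) (P.trunk k) ∧ ∀ σ' : G.Profile, σ' i = s →
      (∀ j, (σ' j).AgreeOn (σ j) (P.trunk k)) →
      (∑ z ∈ G.terminals.filter (fun z => z ∈ P.trunk k), G.util i z * G.reach σ z) +
        ∑ h ∈ G.border (P.trunk k), G.reach σ h * G.contUtil i (ν (P.pub h)) h ≤
      G.utility i σ' := by
  obtain ⟨s, hs, hsν⟩ := P.exists_strategy_extending hG hk (σ i) (fun c => ν c i)
  refine ⟨s, hs, fun σ' hσ' hag => ?_⟩
  have hT := P.isTrunk k hk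
  rw [utility_eq_trunk_add hT]
  refine add_le_add (le_of_eq (Finset.sum_congr rfl fun z hz => ?_)) ?_
  · rw [reach_eq_of_agreeOn hT hag (Or.inl (Finset.mem_filter.1 hz).2)]
  have h1 : ∀ h ∈ G.border (P.trunk k), G.reach σ' h * G.contUtil i σ' h =
      G.reach σ h * G.contUtil i (Function.update (ν (P.pub h)) i.other (σ' i.other)) h := by
    intro h hh
    rw [reach_eq_of_agreeOn hT hag (Or.inr hh)]
    congr 1
    refine contUtil_congr _ _ _ _ fun g a hg hga => ?_
    unfold stepProb
    rcases ht : G.turn g with _ | j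
    · rfl
    · by_cases hj : j = i
      · subst hj
        have hne : j ≠ j.other := by cases j <;> simp [Player.other]
        simp only [hσ', Function.update_of_ne hne]
        exact hsν h hh g (G.prefix_mem _ _ hga) hg ht a
      · have hj' : j = i.other := by cases i <;> cases j <;> simp_all [Player.other]
        subst hj'
        simp
  rw [Finset.sum_congr rfl h1, P.sum_border_eq hk, P.sum_border_eq hk]
  refine Finset.sum_le_sum fun c hc => ?_
  obtain ⟨b, hb, rfl⟩ := Finset.mem_image.1 hc
  have h2 : ∀ (μ : κ → G.Profile), ∑ h ∈ G.roots P.pub (P.pub b),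
      G.reach σ h * G.contUtil i (μ (P.pub h)) h = ∑ h ∈ G.roots P.pub (P.pub b),
      G.reach σ h * G.contUtil i (μ (P.pub b)) h := fun μ =>
    Finset.sum_congr rfl fun h hh => by rw [(Finset.mem_filter.1 hh).2.1]
  rw [h2 ν, h2 (fun c => Function.update (ν c) i.other (σ' i.other)), sum_reach_mul_contUtil,
    sum_reach_mul_contUtil]
  have m1 := G.rangeMass_nonneg P.pub σ (P.pub b) .max
  have m2 := G.rangeMass_nonneg P.pub σ (P.pub b) .min
  by_cases h0 : ∀ j, G.rangeMass P.pub σ (P.pub b) j ≠ 0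
  · refine mul_le_mul_of_nonneg_left ?_ (mul_nonneg m1 m2)
    have h3 := hν b hb (isRanges_ranges h0) i.other (σ' i.other)
    have h4 : ∀ μ : G.Profile,
        G.subUtil P.pub (P.pub b) (G.ranges P.pub σ (P.pub b)) .min μ =
          - G.subUtil P.pub (P.pub b) (G.ranges P.pub σ (P.pub b)) .max μ := by
      intro μ
      simp only [subUtil, contUtil_min_eq_neg hz, mul_neg, Finset.sum_neg_distrib]
    cases i
    · simp only [Player.other, h4] at h3
      exact neg_le_neg_iff.1 h3
    · simp only [Player.other] at h3
      rw [h4, h4]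
      exact neg_le_neg h3
  · push Not at h0
    obtain ⟨j, hj⟩ := h0
    cases j <;> simp [hj]

variable {P} in
open Classical in
theorem IsOptimal.exists_subNash {V : ValueFn A ι κ} (hV : P.IsOptimal V) {k : ℕ} (h1 : 1 ≤ k)
    (hk : k ≤ P.n) (σ : G.Profile) :
    ∃ ν : κ → G.Profile,
      (∀ b ∈ G.border (P.trunk k), G.IsRanges P.pub (P.pub b) (G.ranges P.pub σ (P.pub b)) →
        G.IsSubNash P.pub (P.pub b) (G.ranges P.pub σ (P.pub b)) (ν (P.pub b))) ∧
      ∀ i, G.trunkUtil P.pub V (P.trunk k) i σ =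
        (∑ z ∈ G.terminals.filter (fun z => z ∈ P.trunk k), G.util i z * G.reach σ z) +
          ∑ h ∈ G.border (P.trunk k), G.reach σ h * G.contUtil i (ν (P.pub h)) h := by
  have hex : ∀ c, ∃ ν : G.Profile, P.AtDepthLimit c →
      G.IsRanges P.pub c (G.ranges P.pub σ c) →
        G.IsSubNash P.pub c (G.ranges P.pub σ c) ν ∧ ∀ i, ∀ I ∈ G.pubInfos P.pub i c,
          G.IsInfoValue P.pub c (G.ranges P.pub σ c) ν i I (V c (G.ranges P.pub σ c) i I) := by
    intro c
    by_cases hc : P.AtDepthLimit c ∧ G.IsRanges P.pub c (G.ranges P.pub σ c)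
    · obtain ⟨ν, hν⟩ := hV c hc.1 _ hc.2
      exact ⟨ν, fun _ _ => hν⟩
    · exact ⟨σ, fun a b => absurd ⟨a, b⟩ hc⟩
  choose ν hν using hex
  refine ⟨ν, fun b hb hr => (hν _ (P.atDepthLimit h1 hk hb) hr).1, fun i => ?_⟩
  rw [P.trunkUtil_eq hk, P.sum_border_eq hk, P.sum_border_eq hk]
  congr 1
  refine Finset.sum_congr rfl fun c hc => ?_
  obtain ⟨b, hb, rfl⟩ := Finset.mem_image.1 hc
  by_cases h0 : ∀ h ∈ G.roots P.pub (P.pub b), G.reach σ h = 0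
  · exact Finset.sum_congr rfl fun h hh => by rw [h0 h hh, zero_mul, zero_mul]
  · push Not at h0
    obtain ⟨h, hh, h0⟩ := h0
    have h2 := sum_reach_mul_value
      ((hν _ (P.atDepthLimit h1 hk hb) (isRanges_of_reach_ne_zero hh h0)).2 i)
    convert h2 using 1 <;>
    · exact Finset.sum_congr rfl fun g hg => by rw [(Finset.mem_filter.1 hg).2.1]

variable {P} in
/-- The maximizer can continue below the trunk so that he gets at least what an optimal value
function promises. -/
theorem IsOptimal.exists_max_strategy (hz : G.IsZeroSum) (hG : G.PerfectRecall)
    {V : ValueFn A ι κ} (hV : P.IsOptimal V) {k : ℕ} (h1 : 1 ≤ k) (hk : k ≤ P.n)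
    (s : G.Strategy .max) (t : G.Strategy .min) :
    ∃ s' : G.Strategy .max, s'.AgreeOn s (P.trunk k) ∧
      ∀ t' : G.Strategy .min, t'.AgreeOn t (P.trunk k) →
        G.trunkUtil P.pub V (P.trunk k) .max (profile s t) ≤ G.utility .max (profile s' t') := by
  obtain ⟨ν, hν, hu⟩ := hV.exists_subNash h1 hk (profile s t)
  obtain ⟨s', hs', H⟩ := P.exists_strategy_secure hz hG hk (profile s t) ν hν .max
  refine ⟨s', hs', fun t' ht' => ?_⟩
  rw [hu]
  refine H (profile s' t') rfl fun j => ?_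
  cases j
  · exact hs'
  · exact ht'

variable {P} in
/-- The minimizer can continue below the trunk so that the maximizer gets at most what an optimal
value function promises. -/
theorem IsOptimal.exists_min_strategy (hz : G.IsZeroSum) (hG : G.PerfectRecall)
    {V : ValueFn A ι κ} (hV : P.IsOptimal V) {k : ℕ} (h1 : 1 ≤ k) (hk : k ≤ P.n)
    (s : G.Strategy .max) (t : G.Strategy .min) :
    ∃ t' : G.Strategy .min, t'.AgreeOn t (P.trunk k) ∧
      G.utility .max (profile s t') ≤ G.trunkUtil P.pub V (P.trunk k) .max (profile s t) := by
  classical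
  obtain ⟨ν, hν, hu⟩ := hV.exists_subNash h1 hk (profile s t)
  obtain ⟨t', ht', H⟩ := P.exists_strategy_secure hz hG hk (profile s t) ν hν .min
  refine ⟨t', ht', ?_⟩
  have h2 := H (profile s t') rfl fun j => by
    cases j
    · exact Strategy.AgreeOn.refl _ _
    · exact ht'
  rw [utility_min_eq_neg hz] at h2
  rw [hu]
  have h3 : ∑ z ∈ G.terminals.filter (fun z => z ∈ P.trunk k),
      G.util .min z * G.reach (profile s t) z =
      - ∑ z ∈ G.terminals.filter (fun z => z ∈ P.trunk k),
        G.util .max z * G.reach (profile s t) z := by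
    rw [← Finset.sum_neg_distrib]
    refine Finset.sum_congr rfl fun z h => ?_
    have := hz z (Finset.mem_filter.1 h).1
    rw [show G.util .min z = - G.util .max z by linarith]
    ring
  simp only [h3, contUtil_min_eq_neg hz, mul_neg, Finset.sum_neg_distrib] at h2
  linarith

end SubgamePartitioning

/-! ### Realization plans and the minimax theorem -/

section minimax

variable {G : Game A ι} {i : Player}

theorem ownSeqFrom_append (G : Game A ι) (i : Player) (g t t' : List A) :
    G.ownSeqFrom i g (t ++ t') = G.ownSeqFrom i g t ++ G.ownSeqFrom i (g ++ t) t' := by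
  induction t generalizing g with
  | nil => simp [ownSeqFrom]
  | cons a t ih =>
    simp only [List.cons_append, ownSeqFrom, ih]
    split_ifs <;> simp

theorem ownReach_concat (s : G.Strategy i) (h : List A) (a : A) :
    ownReach s (G.augInfo i (h ++ [a])) = ownReach s (G.augInfo i h) *
      if G.turn h = some i then s.prob (G.info i h) a else 1 := by
  simp only [ownReach, augInfo, ownSeq, ownSeqFrom_append, List.map_append, List.prod_append,
    List.nil_append, ownSeqFrom]
  congr 1
  split_ifs <;> simp

open Classical in
/-- By perfect recall, convex combinations of realization plans are realized by strategies: at each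
information set the two strategies are mixed with weights proportional to the probabilities of
reaching it. -/
theorem PerfectRecall.exists_mixture (hG : G.PerfectRecall) (s s' : G.Strategy i) {a b : ℝ}
    (ha : 0 ≤ a) (hb : 0 ≤ b) (hab : a + b = 1) :
    ∃ m : G.Strategy i,
      (∀ h ∈ G.hist, ownReach m (G.augInfo i h) =
        a * ownReach s (G.augInfo i h) + b * ownReach s' (G.augInfo i h)) ∧
      ∀ J x, s.prob J x = s'.prob J x → m.prob J x = s.prob J x := by
  -- `seq J` is the common value of `H_i` on the information set `J`, while `u J` and `v J` are the
  -- weights of the two strategies there.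
  let seq : ι → List (ι × A) := fun J =>
    if hJ : ∃ h ∈ G.hist, G.turn h = some i ∧ G.info i h = J then G.ownSeq i hJ.choose else []
  have seq_eq : ∀ h ∈ G.hist, G.turn h = some i → seq (G.info i h) = G.ownSeq i h := by
    intro h hh ht
    have hJ : ∃ h' ∈ G.hist, G.turn h' = some i ∧ G.info i h' = G.info i h := ⟨h, hh, ht, rfl⟩
    simp only [seq]
    rw [dif_pos hJ]
    exact hG i _ hJ.choose_spec.1 h hh hJ.choose_spec.2.1 ht hJ.choose_spec.2.2
  let u : ι → ℝ := fun J => a * ((seq J).map fun x => s.prob x.1 x.2).prod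
  let v : ι → ℝ := fun J => b * ((seq J).map fun x => s'.prob x.1 x.2).prod
  have hu : ∀ h ∈ G.hist, G.turn h = some i →
      u (G.info i h) = a * ownReach s (G.augInfo i h) := by
    intro h hh ht
    simp only [u, seq_eq h hh ht]
    rfl
  have hv : ∀ h ∈ G.hist, G.turn h = some i →
      v (G.info i h) = b * ownReach s' (G.augInfo i h) := by
    intro h hh ht
    simp only [v, seq_eq h hh ht]
    rfl
  have hu0 : ∀ h ∈ G.hist, G.turn h = some i → 0 ≤ u (G.info i h) := fun h hh ht => by
    rw [hu h hh ht]
    exact mul_nonneg ha (ownReach_nonneg s hh)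
  have hv0 : ∀ h ∈ G.hist, G.turn h = some i → 0 ≤ v (G.info i h) := fun h hh ht => by
    rw [hv h hh ht]
    exact mul_nonneg hb (ownReach_nonneg s' hh)
  let m : G.Strategy i :=
    { prob := fun J x => if u J + v J = 0 then s.prob J x else
        (u J * s.prob J x + v J * s'.prob J x) / (u J + v J)
      nonneg := by
        intro h hh ht x hx
        have h1 := s.nonneg h hh ht x hx
        have h2 := s'.nonneg h hh ht x hx
        have h3 := hu0 h hh ht
        have h4 := hv0 h hh ht
        split_ifs
        · exact h1
        · positivity
      sum_eq_one := by
        intro h hh ht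
        split_ifs with h0
        · exact s.sum_eq_one h hh ht
        · rw [← Finset.sum_div, Finset.sum_add_distrib, ← Finset.mul_sum, ← Finset.mul_sum,
            s.sum_eq_one h hh ht, s'.sum_eq_one h hh ht, mul_one, mul_one]
          exact div_self h0 }
  refine ⟨m, ?_, ?_⟩
  · intro h
    induction h using List.reverseRecOn with
    | nil =>
      intro _
      simp [ownReach, augInfo, ownSeq, ownSeqFrom, hab]
    | append_singleton h x ih =>
      intro hx
      have hh := G.prefix_mem _ _ hx
      rw [ownReach_concat, ownReach_concat, ownReach_concat, ih hh]
      by_cases ht : G.turn h = some i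
      · simp only [if_pos ht]
        rw [← hu h hh ht, ← hv h hh ht, ← mul_assoc, ← mul_assoc, ← hu h hh ht, ← hv h hh ht]
        have h3 := hu0 h hh ht
        have h4 := hv0 h hh ht
        simp only [m]
        split_ifs with h0
        · have h5 : u (G.info i h) = 0 := by linarith
          have h6 : v (G.info i h) = 0 := by linarith
          simp [h5, h6]
        · field_simp
      · simp only [if_neg ht, mul_one]
  · intro J x e
    simp only [m]
    split_ifs with h0
    · rfl
    · rw [← e, ← add_mul]
      field_simp

/-- The realization plan of a strategy: the player's own contributions to the probabilities of
reaching the leaves. -/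
noncomputable def plan (s : G.Strategy i) : G.terminals → ℝ :=
  fun z => ownReach s (G.augInfo i z)

/-- The realization plans of the strategies that coincide with `s₀` on `F`. -/
def plans (s₀ : G.Strategy i) (F : Finset (List A)) : Set (G.terminals → ℝ) :=
  plan '' {s | s.AgreeOn s₀ F}

theorem plans_nonempty (s₀ : G.Strategy i) (F : Finset (List A)) : (plans s₀ F).Nonempty :=
  ⟨plan s₀, s₀, Strategy.AgreeOn.refl _ _, rfl⟩

theorem PerfectRecall.convex_plans (hG : G.PerfectRecall) (s₀ : G.Strategy i)
    (F : Finset (List A)) : Convex ℝ (plans s₀ F) := by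
  rintro _ ⟨s, hs, rfl⟩ _ ⟨s', hs', rfl⟩ a b ha hb hab
  obtain ⟨m, hm, hm'⟩ := hG.exists_mixture s s' ha hb hab
  refine ⟨m, fun h hh ht x hx => ?_, ?_⟩
  · rw [hm' _ _ ((hs h hh ht x hx).trans (hs' h hh ht x hx).symm)]
    exact hs h hh ht x hx
  · funext z
    exact hm z (mem_terminals.1 z.2).1

open Classical in
/-- Realization plans are continuous images of the behavioural strategies that vanish outside the
information sets, and these form a compact set by Tychonoff's theorem. -/
theorem isCompact_plans (s₀ : G.Strategy i) {F : Finset (List A)} (hF : F ⊆ G.hist) :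
    IsCompact (plans s₀ F) := by
  let K : Set (ι → A → ℝ) :=
    (Set.univ.pi fun _ => Set.univ.pi fun _ => Set.Icc 0 1) ∩
      ({q | ∀ h ∈ G.hist, G.turn h = some i → ∑ a ∈ G.avail h, q (G.info i h) a = 1} ∩
      {q | ∀ h ∈ F, G.turn h = some i → ∀ a ∈ G.avail h,
        q (G.info i h) a = s₀.prob (G.info i h) a})
  have hK : IsCompact K := by
    refine (isCompact_univ_pi fun _ => isCompact_univ_pi fun _ => isCompact_Icc).inter_right
      (IsClosed.inter ?_ ?_)
    · simp only [Set.ofPred_forall]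
      exact isClosed_iInter fun h => isClosed_iInter fun _ => isClosed_iInter fun _ =>
        isClosed_eq (by fun_prop) continuous_const
    · simp only [Set.ofPred_forall]
      exact isClosed_iInter fun h => isClosed_iInter fun _ => isClosed_iInter fun _ =>
        isClosed_iInter fun _ => isClosed_iInter fun _ =>
        isClosed_eq (by fun_prop) continuous_const
  let Φ : (ι → A → ℝ) → G.terminals → ℝ := fun q z =>
    ((G.ownSeq i z).map fun x => q x.1 x.2).prod
  have hΦ : Continuous Φ :=
    continuous_pi fun z => continuous_list_prod _ fun x _ => by fun_prop
  have himg : plans s₀ F = Φ '' K := by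
    ext r
    constructor
    · rintro ⟨s, hs, rfl⟩
      -- Values of `prob` that are never used may be unbounded and are replaced by `0`.
      let ok : ι → A → Prop := fun J a =>
        ∃ h ∈ G.hist, G.turn h = some i ∧ G.info i h = J ∧ a ∈ G.avail h
      have hok : ∀ h ∈ G.hist, G.turn h = some i → ∀ a ∈ G.avail h, ok (G.info i h) a :=
        fun h hh ht a ha => ⟨h, hh, ht, rfl, ha⟩
      refine ⟨fun J a => if ok J a then s.prob J a else 0, ⟨?_, ?_, ?_⟩, ?_⟩
      · intro J _ a _
        simp only
        split_ifs with h0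
        · obtain ⟨h, hh, ht, rfl, ha⟩ := h0
          refine ⟨s.nonneg h hh ht a ha, ?_⟩
          rw [← s.sum_eq_one h hh ht]
          exact Finset.single_le_sum (f := fun a => s.prob (G.info i h) a)
            (fun a ha => s.nonneg h hh ht a ha) ha
        · simp
      · intro h hh ht
        rw [← s.sum_eq_one h hh ht]
        exact Finset.sum_congr rfl fun a ha => if_pos (hok h hh ht a ha)
      · intro h hh ht a ha
        rw [← hs h hh ht a ha]
        exact if_pos (hok h (hF hh) ht a ha)
      · funext z
        simp only [Φ, plan, ownReach]
        congr 1
        refine List.map_congr_left fun x hx => if_pos ?_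
        obtain ⟨g, hg, ht, e, ha⟩ :=
          exists_of_mem_ownSeqFrom (g := []) (mem_terminals.1 z.2).1 hx
        exact ⟨g, hg, ht, e, ha⟩
    · rintro ⟨q, ⟨h1, h2, h3⟩, rfl⟩
      exact ⟨⟨q, fun h _ _ a _ => (h1 (G.info i h) trivial a trivial).1, h2⟩, h3, rfl⟩
  rw [himg]
  exact hK.image hΦ

theorem utility_eq_sum_plan (s : G.Strategy .max) (t : G.Strategy .min) :
    G.utility .max (profile s t) =
      ∑ z : G.terminals, G.util .max z * G.chanceReach z * plan s z * plan t z := by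
  rw [utility, ← Finset.sum_coe_sort]
  refine Finset.sum_congr rfl fun z _ => ?_
  rw [reach_eq]
  simp only [plan, profile]
  ring

/-- The minimax theorem for extensive-form games in which parts of the strategies of both players
are fixed: a value that the maximizer can guarantee if he knows the strategy of the minimizer, he
can guarantee without knowing it. -/
theorem PerfectRecall.minimax (hG : G.PerfectRecall) (s₀ : G.Strategy .max)
    (t₀ : G.Strategy .min) {F F' : Finset (List A)} (hF : F ⊆ G.hist) (hF' : F' ⊆ G.hist) {w : ℝ}
    (H : ∀ t : G.Strategy .min, t.AgreeOn t₀ F' → ∃ s : G.Strategy .max, s.AgreeOn s₀ F ∧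
      w ≤ G.utility .max (profile s t)) :
    ∃ s : G.Strategy .max, s.AgreeOn s₀ F ∧ ∀ t : G.Strategy .min, t.AgreeOn t₀ F' →
      w ≤ G.utility .max (profile s t) := by
  let B : (G.terminals → ℝ) →ₗ[ℝ] (G.terminals → ℝ) →ₗ[ℝ] ℝ :=
    LinearMap.mk₂ ℝ (fun x y => ∑ z : G.terminals, G.util .max z * G.chanceReach z * y z * x z)
      (fun x x' y => by
        simp only [Pi.add_apply, mul_add, Finset.sum_add_distrib])
      (fun c x y => by
        simp only [Pi.smul_apply, smul_eq_mul, Finset.mul_sum]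
        exact Finset.sum_congr rfl fun z _ => by ring)
      (fun x y y' => by
        simp only [Pi.add_apply, mul_add, add_mul, Finset.sum_add_distrib])
      (fun c x y => by
        simp only [Pi.smul_apply, smul_eq_mul, Finset.mul_sum]
        exact Finset.sum_congr rfl fun z _ => by ring)
  have hB : ∀ (s : G.Strategy .max) (t : G.Strategy .min),
      B (plan t) (plan s) = G.utility .max (profile s t) :=
    fun s t => (utility_eq_sum_plan s t).symm
  obtain ⟨_, ⟨t, ht, rfl⟩, _, ⟨s, hs, rfl⟩, hsad⟩ :=
    Sion.exists_isSaddlePointOn (f := fun x y => B x y)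
      (plans_nonempty t₀ F') (hG.convex_plans t₀ F') (isCompact_plans t₀ hF')
      (fun y _ =>
        (B.flip y).continuous_of_finiteDimensional.lowerSemicontinuous.lowerSemicontinuousOn _)
      (fun y _ => ((B.flip y).convexOn (hG.convex_plans t₀ F')).quasiconvexOn)
      (hG.convex_plans s₀ F) (plans_nonempty s₀ F) (isCompact_plans s₀ hF)
      (fun x _ =>
        (B x).continuous_of_finiteDimensional.upperSemicontinuous.upperSemicontinuousOn _)
      (fun x _ => ((B x).concaveOn (hG.convex_plans s₀ F)).quasiconcaveOn)
  refine ⟨s, hs, fun t' ht' => ?_⟩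
  obtain ⟨s', hs', hw⟩ := H t ht
  have := hsad (plan t') ⟨t', ht', rfl⟩ (plan s') ⟨s', hs', rfl⟩
  simp only [hB] at this
  exact hw.trans this

end minimax

/-! ### The restricted Nash response modification -/

section rnr

variable {G : Game A ι} {p : ℝ} {hp : p ∈ Set.Icc (0 : ℝ) 1}

theorem rnr_turn_embed (c : Bool) (h : List A) :
    (G.rnr p hp).turn (embed c h) = G.turn h :=
  G.rnrTurn_embed c h

theorem mem_rnr_avail_embed {c : Bool} {h : List A} {x : Bool ⊕ A} :
    x ∈ (G.rnr p hp).avail (embed c h) ↔ ∃ a ∈ G.avail h, Sum.inr a = x := by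
  change x ∈ availIn G.rnrHist _ ↔ _
  rw [availIn_embed, Finset.mem_map]
  rfl

theorem embed_uncurry_injective {B : Type*} :
    Function.Injective fun x : Bool × List B => embed x.1 x.2 := by
  intro x y e
  exact Prod.ext_iff.2 (embed_injective _ _ _ _ e)

theorem rnr_terminals :
    (G.rnr p hp).terminals = (Finset.univ ×ˢ G.terminals).map
      ⟨fun x : Bool × List A => embed x.1 x.2, embed_uncurry_injective⟩ := by
  ext l
  simp only [mem_terminals, Finset.mem_map, Finset.mem_product, Finset.mem_univ, true_and,
    Function.Embedding.coeFn_mk, Prod.exists]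
  change (l ∈ G.rnrHist ∧ availIn G.rnrHist l = ∅) ↔ _
  constructor
  · rintro ⟨hl, h0⟩
    rcases (G.mem_rnrHist l).1 hl with rfl | ⟨c, h, hh, rfl⟩
    · rw [availIn_rnr_nil, Finset.map_eq_empty] at h0
      simp at h0
    · rw [availIn_embed, Finset.map_eq_empty] at h0
      exact ⟨c, h, ⟨hh, h0⟩, rfl⟩
  · rintro ⟨c, h, ⟨hh, h0⟩, rfl⟩
    refine ⟨(G.embed_mem_rnrHist c h).2 hh, ?_⟩
    rw [availIn_embed, Finset.map_eq_empty]
    exact h0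

theorem rnr_util_embed (i : Player) (c : Bool) (h : List A) :
    (G.rnr p hp).util i (embed c h) = G.util i h := by
  change G.util i (strip _) = _
  rw [strip_embed]

theorem IsZeroSum.rnr (hz : G.IsZeroSum) : (G.rnr p hp).IsZeroSum := by
  intro l hl
  rw [rnr_terminals] at hl
  obtain ⟨⟨c, h⟩, hh, rfl⟩ := Finset.mem_map.1 hl
  simp only [Function.Embedding.coeFn_mk, rnr_util_embed]
  exact hz h (Finset.mem_product.1 hh).2

/-- The name in the modified game of an information set of `G` in copy `c`. -/
def copyInfo (c : Bool) : Player → ι → ι ⊕ (Bool × ι)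
  | .max, I => .inl I
  | .min, I => .inr (c, I)

theorem rnr_info_embed (i : Player) (c : Bool) (h : List A) :
    (G.rnr p hp).info i (embed c h) = copyInfo c i (G.info i h) := by
  cases i
  · exact G.rnrInfo_max_embed c h
  · exact G.rnrInfo_min_embed c h

theorem rnr_ownSeqFrom_embed (i : Player) (c : Bool) (g t : List A) :
    (G.rnr p hp).ownSeqFrom i (embed c g) (t.map Sum.inr) =
      (G.ownSeqFrom i g t).map fun x => (copyInfo c i x.1, Sum.inr x.2) := by
  induction t generalizing g with
  | nil => simp [ownSeqFrom]
  | cons a t ih =>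
    simp only [List.map_cons, ownSeqFrom, rnr_turn_embed, rnr_info_embed, embed_append, ih]
    split_ifs <;> simp

theorem rnr_ownSeq_embed (i : Player) (c : Bool) (h : List A) :
    (G.rnr p hp).ownSeq i (embed c h) =
      (G.ownSeq i h).map fun x => (copyInfo c i x.1, Sum.inr x.2) :=
  rnr_ownSeqFrom_embed i c [] h

theorem PerfectRecall.rnr (hG : G.PerfectRecall) : (G.rnr p hp).PerfectRecall := by
  intro i l hl l' hl' ht ht' e
  rcases (G.mem_rnrHist l).1 hl with rfl | ⟨c, h, hh, rfl⟩
  · simp [Game.rnr, rnrTurn] at ht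
  rcases (G.mem_rnrHist l').1 hl' with rfl | ⟨c', h', hh', rfl⟩
  · simp [Game.rnr, rnrTurn] at ht'
  rw [rnr_turn_embed] at ht ht'
  rw [rnr_info_embed, rnr_info_embed] at e
  rw [rnr_ownSeq_embed, rnr_ownSeq_embed]
  cases i
  · rw [hG .max h hh h' hh' ht ht' (Sum.inl.inj e)]
    rfl
  · have e' := Prod.mk.inj (Sum.inr.inj e)
    rw [hG .min h hh h' hh' ht ht' e'.2, e'.1]

/-- A strategy of the minimizer in the modified game, as she uses it in copy `c`. -/
def minCopy (c : Bool) (τ : (G.rnr p hp).Strategy .min) : G.Strategy .min where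
  prob I a := τ.prob (Sum.inr (c, I)) (Sum.inr a)
  nonneg := by
    intro h hh ht a ha
    have h1 := τ.nonneg (embed c h) ((G.embed_mem_rnrHist c h).2 hh)
      ((rnr_turn_embed c h).trans ht) (Sum.inr a) (mem_rnr_avail_embed.2 ⟨a, ha, rfl⟩)
    rwa [rnr_info_embed] at h1
  sum_eq_one := by
    intro h hh ht
    have h1 := τ.sum_eq_one (embed c h) ((G.embed_mem_rnrHist c h).2 hh)
      ((rnr_turn_embed c h).trans ht)
    change ∑ a ∈ availIn G.rnrHist _, _ = _ at h1
    rwa [rnr_info_embed, availIn_embed, Finset.sum_map] at h1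

/-- A strategy of the maximizer in `G`, used in both copies of the modified game. -/
def ofOriginal (σ : G.Strategy .max) : (G.rnr p hp).Strategy .max where
  prob
    | .inl I, .inr a => σ.prob I a
    | _, _ => 0
  nonneg := by
    intro l hl ht x hx
    rcases (G.mem_rnrHist l).1 hl with rfl | ⟨c, h, hh, rfl⟩
    · simp [Game.rnr, rnrTurn] at ht
    rw [rnr_turn_embed] at ht
    obtain ⟨a, ha, rfl⟩ := mem_rnr_avail_embed.1 hx
    rw [rnr_info_embed]
    exact σ.nonneg h hh ht a ha
  sum_eq_one := by
    intro l hl ht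
    rcases (G.mem_rnrHist l).1 hl with rfl | ⟨c, h, hh, rfl⟩
    · simp [Game.rnr, rnrTurn] at ht
    rw [rnr_turn_embed] at ht
    change ∑ x ∈ availIn G.rnrHist (embed c h), _ = _
    rw [rnr_info_embed, availIn_embed, Finset.sum_map]
    exact σ.sum_eq_one h hh ht

theorem rnr_pathProd_embed (s : (G.rnr p hp).Strategy .max) (t : (G.rnr p hp).Strategy .min)
    (c : Bool) (g u : List A) :
    pathProd ((G.rnr p hp).stepProb (profile s t)) (embed c g) (u.map Sum.inr) =
      pathProd (G.stepProb (profile (toOriginal s) (minCopy c t))) g u := by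
  induction u generalizing g with
  | nil => simp [pathProd]
  | cons a u ih =>
    simp only [List.map_cons, pathProd, embed_append, ih]
    congr 1
    simp only [stepProb, rnr_turn_embed]
    rcases G.turn g with _ | i
    · exact G.rnrChance_embed p c g a
    · simp only [rnr_info_embed]
      cases i <;> rfl

theorem rnr_reach_embed (s : (G.rnr p hp).Strategy .max) (t : (G.rnr p hp).Strategy .min)
    (c : Bool) (h : List A) :
    (G.rnr p hp).reach (profile s t) (embed c h) =
      (if c then p else 1 - p) * G.reach (profile (toOriginal s) (minCopy c t)) h := by
  have h1 := rnr_pathProd_embed s t c [] h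
  rw [reach, reach, ← h1, embed, pathProd]
  congr 1
  cases c <;> rfl

theorem rnr_utility (i : Player) (s : (G.rnr p hp).Strategy .max)
    (t : (G.rnr p hp).Strategy .min) :
    (G.rnr p hp).utility i (profile s t) =
      p * G.utility i (profile (toOriginal s) (minCopy true t)) +
        (1 - p) * G.utility i (profile (toOriginal s) (minCopy false t)) := by
  rw [utility, rnr_terminals, Finset.sum_map, Finset.sum_product, Fintype.sum_bool]
  simp only [Function.Embedding.coeFn_mk, rnr_util_embed, rnr_reach_embed, utility,
    Finset.mul_sum, if_true, Bool.false_eq_true, if_false]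
  congr 1 <;> exact Finset.sum_congr rfl fun z _ => by ring

theorem minCopy_withModel (σF τ : G.Strategy .min) (c : Bool) :
    minCopy c (withModel (hp := hp) σF τ) = if c then σF else τ := by
  cases c <;> rfl

end rnr

/-! ### Counting information sets at the depth limits -/

namespace SubgamePartitioning

variable {G : Game A ι} (P : G.SubgamePartitioning κ)

open Classical in
/-- Each public state met by `X` contains an information set of each player that meets `X`. -/
theorem two_mul_card_pub_le_infoCount {X : Finset (List A)} (hX : X ⊆ G.hist) :
    2 * (X.image P.pub).card ≤ G.infoCount X := by
  have key : ∀ i, (X.image P.pub).card ≤ (X.image (G.augInfo i)).card := by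
    intro i
    let f : AugInfo A ι → κ := fun I =>
      if hI : ∃ h ∈ X, G.augInfo i h = I then P.pub hI.choose else P.pub []
    have hf : X.image P.pub ⊆ (X.image (G.augInfo i)).image f := by
      intro c hc
      obtain ⟨h, hh, rfl⟩ := Finset.mem_image.1 hc
      refine Finset.mem_image.2 ⟨_, Finset.mem_image_of_mem _ hh, ?_⟩
      have hI : ∃ h' ∈ X, G.augInfo i h' = G.augInfo i h := ⟨h, hh, rfl⟩
      simp only [f]
      rw [dif_pos hI]
      exact P.isPublic i _ (hX hI.choose_spec.1) h (hX hh) hI.choose_spec.2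
    exact (Finset.card_le_card hf).trans Finset.card_image_le
  have h1 := key .max
  have h2 := key .min
  rw [infoCount]
  omega

theorem n_pos : 1 ≤ P.n := by
  by_contra h
  have h0 : P.n = 0 := by omega
  have h1 := P.trunk_last
  rw [h0, P.trunk_zero] at h1
  have := G.nil_mem
  simp [← h1] at this

/-- Each step after the first completes a public state at the previous depth limit. -/
theorem exists_border_mem_trunk_succ {m : ℕ} (hm : m < P.n) :
    ∃ b ∈ G.border (P.trunk m), b ∈ P.trunk (m + 1) := by
  obtain ⟨x, hx, hx'⟩ := Finset.exists_of_ssubset (P.trunk_ssubset m hm)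
  have hT := P.isTrunk (m + 1) hm
  obtain ⟨b, hb, hbx⟩ := exists_border_prefix (hT.1 hx) hx'
  exact ⟨b, hb, hT.2.1 x hx b hbx⟩

theorem exists_mem_borderB {m : ℕ} (h1 : 1 ≤ m) (hm : m < P.n) {b : List A}
    (hb : b ∈ G.border (P.trunk m)) : ∃ j ∈ Finset.Ico 1 P.n, b ∈ P.borderB j := by
  classical
  have hb' := mem_border.1 hb
  have hnil : [] ∈ P.trunk m := by
    have hss := P.trunk_ssubset 0 (by omega)
    obtain ⟨x, hx, -⟩ := Finset.exists_of_ssubset hss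
    exact P.trunk_mono h1 hm.le ((P.isTrunk 1 (by omega)).2.1 x hx [] List.nil_prefix)
  have hd : b.dropLast ∈ P.trunk m := by
    rcases hb'.2.2 with rfl | h
    · exact hnil
    · exact h
  have hex : ∃ j, b.dropLast ∈ P.trunk j := ⟨m, hd⟩
  have hj := Nat.find_spec hex
  have hjm : Nat.find hex ≤ m := Nat.find_min' hex hd
  have hj0 : Nat.find hex ≠ 0 := by
    intro h0
    rw [h0, P.trunk_zero] at hj
    simp at hj
  refine ⟨Nat.find hex, Finset.mem_Ico.2 ⟨by omega, by omega⟩, ?_⟩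
  refine Finset.mem_filter.2 ⟨mem_border.2 ⟨hb'.1, fun h => hb'.2.1 ?_, Or.inr hj⟩, hj, ?_⟩
  · exact P.trunk_mono hjm hm.le h
  · exact Nat.find_min hex (by omega)

/-- Each of the `n - 1` later steps completes a new public state, which lies directly below some
earlier subgame, and each of these public states contains information sets of both players. -/
theorem two_mul_le_sum_infoCount_borderB :
    2 * (P.n - 1) ≤ ∑ k ∈ Finset.Ico 1 P.n, G.infoCount (P.borderB k) := by
  classical
  have hsub : ∀ k, P.borderB k ⊆ G.hist := fun k h hh =>
    (mem_border.1 (Finset.mem_filter.1 hh).1).1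
  refine le_trans ?_ (Finset.sum_le_sum fun k _ => P.two_mul_card_pub_le_infoCount (hsub k))
  rw [← Finset.mul_sum]
  refine Nat.mul_le_mul_left 2 (le_trans ?_ Finset.card_biUnion_le)
  choose! b hb hb' using fun m (hm : m < P.n) => P.exists_border_mem_trunk_succ hm
  rw [← Nat.card_Ico 1 P.n]
  refine Finset.card_le_card_of_injOn (fun m => P.pub (b m)) ?_ ?_
  · intro m hm
    obtain ⟨h1, h2⟩ := Finset.mem_Ico.1 hm
    obtain ⟨j, hj, hbj⟩ := P.exists_mem_borderB h1 h2 (hb m h2)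
    exact Finset.mem_biUnion.2 ⟨j, hj, Finset.mem_image_of_mem _ hbj⟩
  · -- The earlier trunk contains the whole public state, the later one is not yet reached.
    have key : ∀ m m', m < m' → m' < P.n → P.pub (b m) ≠ P.pub (b m') := by
      intro m m' hlt hm' e
      have h1 := mem_border.1 (hb m (by omega))
      have h2 := mem_border.1 (hb m' hm')
      refine h2.2.1 ((P.mem_trunk_iff hm'.le h1.1 h2.1 e).1 ?_)
      exact P.trunk_mono hlt hm'.le (hb' m (by omega))
    intro m hm m' hm' e
    have h1 := (Finset.mem_Ico.1 hm).2
    have h2 := (Finset.mem_Ico.1 hm').2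
    rcases lt_trichotomy m m' with h | h | h
    · exact absurd e (key m m' h h2)
    · exact h
    · exact absurd e.symm (key m' m h h1)

/-- Errors of value functions are nonnegative if there is a depth limit at all. -/
theorem ErrorLE.nonneg {P : G.SubgamePartitioning κ} {V V' : ValueFn A ι κ} {ε : ℝ}
    (hV : P.ErrorLE V' V ε) (hn : 1 < P.n) : 0 ≤ ε := by
  classical
  obtain ⟨b, hb, -⟩ := P.exists_border_mem_trunk_succ hn
  have hr : b ∈ G.roots P.pub (P.pub b) := (P.mem_roots_iff hn.le hb b).2 ⟨hb, rfl⟩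
  have hρ : G.IsRanges P.pub (P.pub b) fun i I => if I = G.augInfo i b then 1 else 0 := by
    intro i
    have hi := augInfo_mem_pubInfos hr i
    refine ⟨fun I => ?_, fun I hI => if_neg ?_, ?_⟩
    · dsimp only
      split_ifs <;> norm_num
    · rintro rfl
      exact hI hi
    · simp only [Finset.sum_ite_eq', if_pos hi]
  have h1 := hV _ (P.atDepthLimit le_rfl hn.le hb) _ hρ .max _ (augInfo_mem_pubInfos hr .max)
  exact (abs_nonneg _).trans h1

end SubgamePartitioning

/-! ### Continual depth-limited restricted Nash responses -/

section cdrnr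

variable {G : Game A ι} {p : ℝ} {hp : p ∈ Set.Icc (0 : ℝ) 1}
  {P : (G.rnr p hp).SubgamePartitioning κ}
  {V V' : ValueFn (Bool ⊕ A) (ι ⊕ (Bool × ι)) κ} {εV εR : ℝ} {σF : G.Strategy .min}

/-- The bound for the effect of the errors of the value function on utilities in the `k`-th trunk:
no value function is used in the last trunk, the whole game. -/
noncomputable def stepError (P : (G.rnr p hp).SubgamePartitioning κ) (εV : ℝ) (k : ℕ) : ℝ :=
  if k < P.n then εV else 0

theorem abs_trunkUtil_sub_le_stepError (hV' : P.ErrorLE V' V εV) {k : ℕ} (h1 : 1 ≤ k)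
    (hk : k ≤ P.n) (σ : (G.rnr p hp).Profile) :
    |(G.rnr p hp).trunkUtil P.pub V' (P.trunk k) .max σ -
      (G.rnr p hp).trunkUtil P.pub V (P.trunk k) .max σ| ≤ stepError P εV k := by
  rw [stepError]
  split_ifs with h
  · exact P.abs_trunkUtil_sub_le hV' (hV'.nonneg (by omega)) h1 hk _ _
  · obtain rfl : k = P.n := by omega
    rw [P.trunkUtil_last, P.trunkUtil_last, sub_self, abs_zero]

open Classical in
/-- The histories of a set that lie in the copy of the game in which the minimizer follows the
model. -/
noncomputable def modelPart {B : Type*} (T : Finset (List (Bool ⊕ B))) :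
    Finset (List (Bool ⊕ B)) :=
  T.filter fun l => ∃ h : List B, l = embed true h

theorem modelPart_subset {B : Type*} (T : Finset (List (Bool ⊕ B))) : modelPart T ⊆ T := by
  classical
  exact Finset.filter_subset _ _

theorem modelPart_mono {B : Type*} {T T' : Finset (List (Bool ⊕ B))} (h : T ⊆ T') :
    modelPart T ⊆ modelPart T' := by
  classical
  exact Finset.filter_subset_filter _ h

/-- A strategy of the minimizer that follows the model on the part of `T` in the model copy coincides
on `T` with one that follows the model in this whole copy. -/
theorem agreeOn_withModel {T : Finset (List (Bool ⊕ A))} (hT : T ⊆ (G.rnr p hp).hist)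
    {t : (G.rnr p hp).Strategy .min} (ht : t.AgreeOn (withModel σF σF) (modelPart T)) :
    t.AgreeOn (withModel σF (minCopy false t)) T := by
  classical
  intro l hl htu x hx
  rcases (G.mem_rnrHist l).1 (hT hl) with rfl | ⟨c, h, hh, rfl⟩
  · simp [Game.rnr, rnrTurn] at htu
  obtain ⟨a, ha, rfl⟩ := mem_rnr_avail_embed.1 hx
  cases c
  · rw [rnr_info_embed]
    rfl
  · rw [ht _ (Finset.mem_filter.2 ⟨hl, h, rfl⟩) htu _ hx, rnr_info_embed]
    rfl

theorem withModel_agreeOn (σF τ : G.Strategy .min) (T : Finset (List (Bool ⊕ A))) :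
    (withModel (hp := hp) σF τ).AgreeOn (withModel σF σF) (modelPart T) := by
  classical
  intro l hl htu x hx
  obtain ⟨-, h, rfl⟩ := Finset.mem_filter.1 hl
  obtain ⟨a, ha, rfl⟩ := mem_rnr_avail_embed.1 hx
  rw [rnr_info_embed]
  rfl

/-- What the maximizer is guaranteed in the whole game against a minimizer who follows the model in
the trunk, an approximate value function shows in the trunk up to its error. -/
theorem le_worstUtil (hz : G.IsZeroSum) (hG : G.PerfectRecall) (hV : P.IsOptimal V)
    (hV' : P.ErrorLE V' V εV) {k : ℕ} (h1 : 1 ≤ k) (hk : k ≤ P.n) {w : ℝ}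
    (s : (G.rnr p hp).Strategy .max)
    (H : ∀ t : (G.rnr p hp).Strategy .min, t.AgreeOn (withModel σF σF) (modelPart (P.trunk k)) →
      w ≤ (G.rnr p hp).utility .max (profile s t)) (τ : G.Strategy .min) :
    w - stepError P εV k ≤
      (G.rnr p hp).trunkUtil P.pub V' (P.trunk k) .max (profile s (withModel σF τ)) := by
  obtain ⟨t, ht, hu⟩ := hV.exists_min_strategy hz.rnr hG.rnr h1 hk s (withModel σF τ)
  have h2 := H t fun l hl htu x hx =>
    (ht l (modelPart_subset _ hl) htu x hx).trans
      (withModel_agreeOn σF τ _ l hl htu x hx)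
  have h3 := (abs_le.1 (abs_trunkUtil_sub_le_stepError hV' h1 hk (profile s (withModel σF τ)))).1
  linarith

theorem worstUtil_le (hz : G.IsZeroSum) (hG : G.PerfectRecall) (hV : P.IsOptimal V)
    (hV' : P.ErrorLE V' V εV) {k : ℕ} (h1 : 1 ≤ k) (hk : k ≤ P.n)
    (s : (G.rnr p hp).Strategy .max) (τ : G.Strategy .min) :
    worstUtil P.pub V' σF (P.trunk k) s ≤
      (G.rnr p hp).trunkUtil P.pub V' (P.trunk k) .max (profile s (withModel σF τ)) := by
  refine ciInf_le ⟨-∑ z ∈ (G.rnr p hp).terminals, |(G.rnr p hp).util .max z| -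
    stepError P εV k, ?_⟩ τ
  rintro _ ⟨τ', rfl⟩
  exact le_worstUtil hz hG hV hV' h1 hk s (fun t _ => neg_sum_abs_le_utility _ _ _) τ'

/-- One step of the response: on the next subgame the maximizer can secure, up to errors, what the
value function promised at the previous depth limit. By optimality of the exact value function he
can do so if he knows the strategy of the minimizer, and hence, by the minimax theorem, also if he
does not. -/
theorem worstUtil_step (hz : G.IsZeroSum) (hG : G.PerfectRecall) (hV : P.IsOptimal V)
    (hV' : P.ErrorLE V' V εV) {σR : (G.rnr p hp).Strategy .max} (hσR : IsCDRNR P V' σF εR σR)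
    {k : ℕ} (h1 : 1 ≤ k) (hk : k < P.n) :
    worstUtil P.pub V' σF (P.trunk k) σR - stepError P εV k - stepError P εV (k + 1) ≤
      worstUtil P.pub V' σF (P.trunk (k + 1)) σR + εR := by
  have hT := (P.isTrunk k hk.le).1
  obtain ⟨s, hs, hsw⟩ := hG.rnr.minimax σR (withModel σF σF) hT ((modelPart_subset _).trans hT)
    (w := worstUtil P.pub V' σF (P.trunk k) σR - stepError P εV k) (by
      intro t ht
      obtain ⟨s', hs', hu⟩ := hV.exists_max_strategy hz.rnr hG.rnr h1 hk.le σR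
        (withModel σF (minCopy false t))
      refine ⟨s', hs', ?_⟩
      have h2 := hu t (agreeOn_withModel hT ht)
      have h3 := worstUtil_le (σF := σF) hz hG hV hV' h1 hk.le σR (minCopy false t)
      have h4 := (abs_le.1 (abs_trunkUtil_sub_le_stepError hV' h1 hk.le
        (profile σR (withModel σF (minCopy false t))))).2
      linarith)
  refine le_trans ?_ (hσR k hk s hs)
  have : Nonempty (G.Strategy .min) := ⟨σF⟩
  refine le_ciInf fun τ => le_worstUtil hz hG hV hV' (by omega) hk s (fun t ht => hsw t ?_) τ
  exact ht.mono (modelPart_mono (P.trunk_mono (Nat.le_succ k) hk))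

theorem IsNash.utility_max_le {σ : G.Profile} (hσ : G.IsNash σ) (hz : G.IsZeroSum)
    (τ : G.Strategy .min) : G.utility .max σ ≤ G.utility .max (profile (σ .max) τ) := by
  have h := hσ .min τ
  have e : Function.update σ .min τ = profile (σ .max) τ := by
    funext i
    cases i <;> simp [profile]
  rw [e, utility_min_eq_neg hz, utility_min_eq_neg hz] at h
  linarith

theorem utility_le_worstUtil (hz : G.IsZeroSum) (hG : G.PerfectRecall) (hV : P.IsOptimal V)
    (hV' : P.ErrorLE V' V εV) {σR : (G.rnr p hp).Strategy .max} (hσR : IsCDRNR P V' σF εR σR)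
    {σNE : G.Profile} (hNE : G.IsNash σNE) {k : ℕ} (h1 : 1 ≤ k) (hk : k ≤ P.n) :
    G.utility .max σNE ≤ worstUtil P.pub V' σF (P.trunk k) σR + k * εR + 2 * (k - 1) * εV +
      stepError P εV k := by
  induction k, h1 using Nat.le_induction with
  | base =>
    have h2 : G.utility .max σNE - stepError P εV 1 ≤
        worstUtil P.pub V' σF (P.trunk 1) (ofOriginal (hp := hp) (σNE .max)) := by
      have : Nonempty (G.Strategy .min) := ⟨σF⟩
      refine le_ciInf fun τ => le_worstUtil hz hG hV hV' le_rfl hk _ (fun t _ => ?_) τ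
      rw [rnr_utility]
      have h3 := mul_le_mul_of_nonneg_left (hNE.utility_max_le hz (minCopy true t)) hp.1
      have h4 := mul_le_mul_of_nonneg_left (hNE.utility_max_le hz (minCopy false t))
        (sub_nonneg.2 hp.2)
      change _ ≤ p * G.utility .max (profile (σNE .max) _) +
        (1 - p) * G.utility .max (profile (σNE .max) _)
      linarith
    have h3 := hσR 0 hk (ofOriginal (σNE .max)) fun h hh => by
      rw [P.trunk_zero] at hh
      simp at hh
    rw [zero_add] at h3
    push_cast
    linarith
  | succ k h1 ih =>
    have h2 := ih (by omega)
    have h3 := worstUtil_step hz hG hV hV' hσR h1 hk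
    have h4 : stepError P εV k = εV := if_pos hk
    rw [h4] at h2 h3
    push_cast
    linarith

theorem worstUtil_last_le (hz : G.IsZeroSum) (hG : G.PerfectRecall) (hV : P.IsOptimal V)
    (hV' : P.ErrorLE V' V εV) (σ : (G.rnr p hp).Strategy .max) :
    worstUtil P.pub V' σF (P.trunk P.n) σ ≤ G.utility .max (profile (toOriginal σ) σF) := by
  refine (worstUtil_le hz hG hV hV' P.n_pos le_rfl σ σF).trans (le_of_eq ?_)
  rw [P.trunkUtil_last, rnr_utility, minCopy_withModel, minCopy_withModel]
  simp only [ite_self]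
  ring

end cdrnr

end Game

theorem theorem2 {A ι κ : Type*} [Fintype A]
    (G : Game A ι) (hzero : G.IsZeroSum) (hrecall : G.PerfectRecall)
    (σF : G.Strategy .min)
    (p : ℝ) (hp : p ∈ Set.Icc (0 : ℝ) 1)
    (P : (G.rnr p hp).SubgamePartitioning κ)
    (V V' : Game.ValueFn (Bool ⊕ A) (ι ⊕ (Bool × ι)) κ)
    (hV : P.IsOptimal V)
    (εV εR : ℝ) (hV' : P.ErrorLE V' V εV)
    (σR : (G.rnr p hp).Strategy .max) (hσR : Game.IsCDRNR P V' σF εR σR)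
    (σNE : G.Profile) (hNE : G.IsNash σNE) :
    G.utility .max σNE ≤
      G.utility .max (Game.profile (Game.toOriginal σR) σF)
        + ∑ k ∈ Finset.Ico 1 P.n, ((G.rnr p hp).infoCount (P.borderO k) : ℝ) * (1 - p) * εV
        + (P.n : ℝ) * εR
        + ∑ k ∈ Finset.Ico 1 P.n, ((G.rnr p hp).infoCount (P.borderB k) : ℝ) * εV := by
  have h1 := Game.utility_le_worstUtil hzero hrecall hV hV' hσR hNE P.n_pos le_rfl
  have h2 := Game.worstUtil_last_le (σF := σF) hzero hrecall hV hV' σR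
  have h3 : Game.stepError P εV P.n = 0 := if_neg (lt_irrefl _)
  have h4 : 2 * ((P.n : ℝ) - 1) * εV ≤
      ∑ k ∈ Finset.Ico 1 P.n, ((G.rnr p hp).infoCount (P.borderB k) : ℝ) * εV ∧
      0 ≤ ∑ k ∈ Finset.Ico 1 P.n,
        ((G.rnr p hp).infoCount (P.borderO k) : ℝ) * (1 - p) * εV := by
    rcases P.n_pos.eq_or_lt with hn | hn
    · simp [← hn]
    · have hε := hV'.nonneg hn
      have hp1 : 0 ≤ 1 - p := sub_nonneg.2 hp.2
      refine ⟨?_, Finset.sum_nonneg fun k _ => by positivity⟩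
      rw [← Finset.sum_mul]
      refine mul_le_mul_of_nonneg_right ?_ hε
      have h5 : ((2 * (P.n - 1) : ℕ) : ℝ) ≤
          ((∑ k ∈ Finset.Ico 1 P.n, (G.rnr p hp).infoCount (P.borderB k) : ℕ) : ℝ) :=
        Nat.cast_le.2 P.two_mul_le_sum_infoCount_borderB
      push_cast [Nat.cast_sub P.n_pos] at h5
      exact h5
  linarith [h4.1, h4.2]
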